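/- Let $A$ be a finite alphabet. A sentence $I=(w_1,\dots,w_k)$ is a finite sequence of non-empty words over $A$; $\ell(I)=k$, $|I|=\sum_i|w_i|$, $w(I)=w_1\cdots w_k$, and $I^r=(w_k,\dots,w_1)$. Write $I\preceq J$ if $J$ arises from $I$ by concatenating some adjacent words. For sentences $J=(v_1,\dots,v_h)$ and $I=(w_1,\dots,w_k)$ write $J\subseteq_L I$ if $h\le k$ and $v_i$ is a prefix of $w_i$ for $1\le i\le h$. Let $NSym_A$ be the $\mathbb{Q}$-algebra with basis $\{H_I\}$ indexed by sentences and product $H_IH_J=H_{I\cdot J}$ (concatenation of sequences), and let $R_I=\sum_{J\succeq I}(-1)^{\ell(J)-\ell(I)}H_J$. Let $x_{a,i}$ ($a\in A$, $i\ge 1$) be variables such that $x_{a,i}$ and $x_{b,j}$ commute if $i\neq j$, with no relation between those with the same second index; put $x_{w,i}=x_{a_1,i}\cdots x_{a_n,i}$ for a word $w=a_1\cdots a_n$. Let $QSym_A$ be the algebra of formal power series over $\mathbb{Q}$ in these variables, of bounded degree, with basis $M_I=\sum_{j_1<\dots<j_k}x_{w_1,j_1}\cdots x_{w_k,j_k}$,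 and let $F_I=\sum_{J\preceq I}M_J$ and $\Delta(M_I)=\sum_{I=J\cdot K}M_J\otimes M_K$. Let $\langle\cdot,\cdot\rangle: NSym_A\times QSym_A\to\mathbb{Q}$ be the bilinear pairing with $\langle H_I,M_J\rangle=\delta_{I,J}$, and for $G\in QSym_A$ let $G^{\perp}$ be the operator on $NSym_A$ with $\langle G^{\perp}f,g\rangle=\langle f,gG\rangle$ for all $g \in QSym_A$. For a non-empty word $v$ let $\mathbb{B}_v=\sum_{Q}(-1)^{\ell(Q)}H_{(v\cdot w(Q^r))}\sum_{S\succeq Q}M_S^{\perp}$, the outer sum being over all sentences $Q$ (only finitely many terms are non-zero on a given element). The colored immaculate function of $J=(v_1,\dots,v_h)$ is $\mathfrak{S}_J=\mathbb{B}_{v_1}\cdots\mathbb{B}_{v_h}(1)$. For $J\subseteq_L I$, a skew colored immaculate tableau $T$ of shape $I/J$ is a filling with positive integers of the boxes $(i,j)$ with $1\le i\le k$ and $|v_i|<j\le|w_i|$ (where $|v_i|=0$ for $i>h$), weakly increasing along rows from left to right and strictly increasing from top to bottom along the boxes $(i,1)$. Box $(i,j)$ has as color the $j$-th letter of $w_i$.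 Put $x_T=x_{u_1,1}x_{u_2,2}\cdots$, where $u_n$ is the word of the colors of the boxes with entry $n$, read from left to right within rows, from the bottom row to the top row. The colored dual immaculate function $\mathfrak{S}^*_I\in QSym_A$ is $\sum_T x_T$ over all tableaux $T$ of shape $I/\emptyset$. For $J\subseteq_L I$, the skew colored dual immaculate function is $\mathfrak{S}^*_{I/J}=\sum_K\langle\mathfrak{S}_JH_K,\mathfrak{S}^*_I\rangle M_K$, over all sentences $K$ with $|K|=|I|-|J|$. Proposition. 1. The functions $\mathfrak{S}_I$ form a basis of $NSym_A$, and the structure constants in $\mathfrak{S}_J\mathfrak{S}_K=\sum_I c^I_{J,K}\mathfrak{S}_I$ are $c^I_{J,K}=\langle\mathfrak{S}_J\mathfrak{S}_K,\mathfrak{S}^*_I\rangle$ for all sentences $I,J,K$. 2. For all sentences $J\subseteq_L I$, $$\mathfrak{S}^*_{I/J}=\sum_K\langle\mathfrak{S}_JR_K,\mathfrak{S}^*_I\rangle F_K=\sum_K\langle\mathfrak{S}_J\mathfrak{S}_K,\mathfrak{S}^*_I\rangle\mathfrak{S}^*_K=\sum_K c^I_{J,K}\mathfrak{S}^*_K,$$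 where the sums run over all sentences $K$ with $|K|=|I|-|J|$. 3. For all sentences $J\subseteq_L I$, $\mathfrak{S}^*_{I/J}=\sum_T x_T$, where the sum runs over all skew colored immaculate tableaux $T$ of shape $I/J$. 4. For every sentence $I$, $\Delta(\mathfrak{S}^*_I)=\sum_{J\subseteq_L I}\mathfrak{S}^*_J\otimes\mathfrak{S}^*_{I/J}$, where the sum runs over all sentences $J$ with $J\subseteq_L I$. -/

import Mathlib

open scoped TensorProduct

noncomputable section

namespace ColoredQSym

universe u

/-! ### Words, sentences, and their orders -/

/-- A non-empty word over the alphabet `A`. -/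
abbrev Word (A : Type u) : Type u := {w : List A // w ≠ []}

/-- A sentence: a finite sequence of non-empty words. -/
abbrev Sentence (A : Type u) : Type u := List (Word A)

/-- The concatenation of a non-empty word with an arbitrary word. -/
def Word.append {A : Type u} (v : Word A) (u : List A) : Word A :=
  ⟨v.1 ++ u, by simp [v.2]⟩

/-- The size of a sentence: its total number of letters. -/
def size {A : Type u} (I : Sentence A) : ℕ := (I.map fun w => w.1.length).sum

/-- The maximal word `w(I)`: the concatenation of all words of `I`. -/
def maxWord {A : Type u} (I : Sentence A) : List A := (I.map Subtype.val).flatten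

/-- The word in row `r` (rows are numbered from `0`), empty if there is no such row. -/
def wordAt {A : Type u} (I : Sentence A) (r : ℕ) : List A := (I[r]?.map Subtype.val).getD []

/-- A list of letters as a non-empty word, if it is one. -/
def toWord {A : Type u} : List A → Option (Word A)
  | [] => none
  | a :: l => some ⟨a :: l, List.cons_ne_nil a l⟩

/-- The flattening of a weak sentence: remove all empty words. -/
def flattening {A : Type u} (W : List (List A)) : Sentence A := W.filterMap toWord

/-- Left containment `J ⊆_L I`, for a sentence `J` with at most as many words as `I`: every word of
`J` is a prefix of the word of `I` in the same row (`J` is padded by empty words). -/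
def LeftContained {A : Type u} (J I : Sentence A) : Prop :=
  J.length ≤ I.length ∧ ∀ r, wordAt J r <+: wordAt I r

/-- `Refines I J` says that `I ⪯ J`: the sentence `J` is obtained from `I` by concatenating some
adjacent words. -/
inductive Refines {A : Type u} : Sentence A → Sentence A → Prop
  | nil : Refines [] []
  | keep (w : Word A) {I J : Sentence A} : Refines I J → Refines (w :: I) (w :: J)
  | glue (w v : Word A) {I J : Sentence A} :
      Refines I (v :: J) → Refines (w :: I) (w.append v.1 :: J)

theorem Refines.size_eq {A : Type u} {I J : Sentence A} (h : Refines I J) : size J = size I := by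
  induction h with
  | nil => rfl
  | keep w _ ih => simpa [size] using ih
  | glue w v _ ih =>
    simp only [size, List.map_cons, List.sum_cons, Word.append, List.length_append] at ih ⊢
    omega

theorem length_le_size {A : Type u} (I : Sentence A) : I.length ≤ size I := by
  induction I with
  | nil => simp
  | cons w I ih =>
    have := List.length_pos_iff.2 w.2
    simp only [size, List.map_cons, List.sum_cons, List.length_cons] at ih ⊢
    omega

theorem word_length_le_size {A : Type u} (I : Sentence A) (w : Word A) (h : w ∈ I) :
    w.1.length ≤ size I :=
  List.single_le_sum (by simp) _ (List.mem_map_of_mem h)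

theorem finite_lists {α : Type u} {s : Set α} (hs : s.Finite) (n : ℕ) :
    {l : List α | l.length ≤ n ∧ ∀ x ∈ l, x ∈ s}.Finite := by
  have : Finite s := hs
  refine ((List.finite_length_le s n).image (List.map Subtype.val)).subset ?_
  rintro l ⟨hl, h⟩
  exact ⟨l.attach.map fun x => ⟨x.1, h x.1 x.2⟩, by simpa using hl, by simp⟩

theorem finite_size_le {A : Type u} [Finite A] (n : ℕ) : {I : Sentence A | size I ≤ n}.Finite := by
  have hw : {w : Word A | w.1.length ≤ n}.Finite :=
    (List.finite_length_le A n).preimage Subtype.val_injective.injOn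
  exact (finite_lists hw n).subset fun I hI =>
    ⟨(length_le_size I).trans hI, fun w h => (word_length_le_size I w h).trans hI⟩

theorem finite_size_eq {A : Type u} [Finite A] (n : ℕ) : {I : Sentence A | size I = n}.Finite :=
  (finite_size_le n).subset fun _ h => le_of_eq h

/-- All sentences of size `n` over a finite alphabet. -/
def sentences (A : Type u) [Finite A] (n : ℕ) : Finset (Sentence A) :=
  (finite_size_eq (A := A) n).toFinset

open Classical in
/-- All coarsenings `J ⪰ I` of a sentence `I`. -/
def coarsenings {A : Type u} [Finite A] (I : Sentence A) : Finset (Sentence A) :=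
  {J ∈ sentences A (size I) | Refines I J}

open Classical in
/-- All refinements `J ⪯ I` of a sentence `I`. -/
def refinements {A : Type u} [Finite A] (I : Sentence A) : Finset (Sentence A) :=
  {J ∈ sentences A (size I) | Refines J I}

theorem mem_coarsenings {A : Type u} [Finite A] {I J : Sentence A} :
    J ∈ coarsenings I ↔ Refines I J := by
  simp only [coarsenings, sentences, Finset.mem_filter, Set.Finite.mem_toFinset, Set.mem_ofPred_eq,
    and_iff_right_iff_imp]
  exact fun h => h.size_eq

theorem mem_refinements {A : Type u} [Finite A] {I J : Sentence A} :
    J ∈ refinements I ↔ Refines J I := by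
  simp only [refinements, sentences, Finset.mem_filter, Set.Finite.mem_toFinset, Set.mem_ofPred_eq,
    and_iff_right_iff_imp]
  exact fun h => h.size_eq.symm

theorem finite_leftContained {A : Type u} (I : Sentence A) :
    {J : Sentence A | LeftContained J I}.Finite := by
  have hw : {w : Word A | ∃ r < I.length, w.1 <+: wordAt I r}.Finite := by
    have : (⋃ r ∈ Finset.range I.length, {w : List A | w <+: wordAt I r}).Finite := by
      refine Set.Finite.biUnion (Finset.finite_toSet _) fun r _ => ?_
      refine (List.finite_toSet (wordAt I r).inits).subset fun w hw => ?_
      simpa using hw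
    refine (this.preimage Subtype.val_injective.injOn).subset ?_
    rintro w ⟨r, hr, h⟩
    simp only [Set.mem_preimage, Set.mem_iUnion, Finset.mem_range, exists_prop]
    exact ⟨r, hr, h⟩
  refine (finite_lists hw I.length).subset ?_
  rintro J ⟨hl, h⟩
  refine ⟨hl, fun w hwJ => ?_⟩
  obtain ⟨r, hr, rfl⟩ := List.getElem_of_mem hwJ
  refine ⟨r, by omega, ?_⟩
  have := h r
  simpa [wordAt, hr] using this

/-- All sentences `J` with `J ⊆_L I`. -/
def subSentences {A : Type u} (I : Sentence A) : Finset (Sentence A) :=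
  (finite_leftContained I).toFinset

/-! ### Formal power series in partially commutative variables -/

/-- Monomials in the variables `x_{a,i}` (`a` a color, `i` a positive integer), where `x_{a,i}` and
`x_{b,j}` commute exactly when `i ≠ j` or `a = b`. A monomial is written uniquely as
`x_{w_1,1} x_{w_2,2} ⋯` with words `w_i`, almost all of them empty; it is recorded as the finitely
supported function `i ↦ w_i`. Addition of these functions is the product of monomials. -/
abbrev Monomial (A : Type u) : Type u := ℕ+ →₀ FreeAddMonoid A

/-- The sentence of a monomial: its non-empty words in the order of their indices. -/
def sentenceOf {A : Type u} (m : Monomial A) : Sentence A :=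
  flattening ((m.support.sort (· ≤ ·)).map fun i => (m i).toList)

/-- Formal power series with rational coefficients, as coefficient functions. -/
abbrev Series (A : Type u) : Type u := Monomial A → ℚ

theorem finite_splittings {A : Type u} (m : Monomial A) :
    {p : Monomial A × Monomial A | p.1 + p.2 = m}.Finite := by
  classical
  have key : ∀ p q : Monomial A, p + q = m → ∀ i,
      (p i).toList ++ (q i).toList = (m i).toList := by
    rintro p q rfl i
    rfl
  have hnil : ∀ i, i ∉ m.support → (m i).toList = [] := by
    intro i hi
    rw [Finsupp.notMem_support_iff.1 hi]; rfl
  have h0 : ∀ w : FreeAddMonoid A, w.toList = [] → w = 0 := fun w h => h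
  let P : Finset (Monomial A) := m.support.finsupp fun i =>
    ((m i).toList.inits.map FreeAddMonoid.ofList).toFinset
  let S : Finset (Monomial A) := m.support.finsupp fun i =>
    ((m i).toList.tails.map FreeAddMonoid.ofList).toFinset
  refine (P ×ˢ S).finite_toSet.subset ?_
  rintro ⟨p, q⟩ h
  have h' := key p q h
  rw [Finset.mem_coe, Finset.mem_product]
  change p ∈ m.support.finsupp _ ∧ q ∈ m.support.finsupp _
  rw [Finset.mem_finsupp_iff, Finset.mem_finsupp_iff]
  refine ⟨⟨fun i hi => ?_, fun i _ => ?_⟩, ⟨fun i hi => ?_, fun i _ => ?_⟩⟩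
  · by_contra hc
    have := h' i
    rw [hnil i hc] at this
    exact (Finsupp.mem_support_iff.1 hi) (h0 _ (List.append_eq_nil_iff.1 this).1)
  · rw [List.mem_toFinset]
    exact List.mem_map.2 ⟨(p i).toList, (List.mem_inits _ _).2 ⟨_, h' i⟩, rfl⟩
  · by_contra hc
    have := h' i
    rw [hnil i hc] at this
    exact (Finsupp.mem_support_iff.1 hi) (h0 _ (List.append_eq_nil_iff.1 this).2)
  · rw [List.mem_toFinset]
    exact List.mem_map.2 ⟨(q i).toList, (List.mem_tails _ _).2 ⟨_, h' i⟩, rfl⟩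

/-- The product of formal power series (the instance `*` on functions is pointwise and not used). -/
def Series.mul {A : Type u} (f g : Series A) : Series A := fun m =>
  ∑ p ∈ (finite_splittings m).toFinset, f p.1 * g p.2

/-- The colored quasisymmetric functions: power series of bounded degree in which monomials with
the same sentence have the same coefficient. -/
def QSym (A : Type u) : Submodule ℚ (Series A) where
  carrier := {f | (∀ m m', sentenceOf m = sentenceOf m' → f m = f m') ∧
    ∃ N, ∀ m, f m ≠ 0 → size (sentenceOf m) ≤ N}
  zero_mem' := ⟨fun _ _ _ => rfl, 0, fun _ h => absurd rfl h⟩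
  add_mem' := by
    rintro f g ⟨hf, N, hN⟩ ⟨hg, N', hN'⟩
    refine ⟨fun m m' h => by simp [hf m m' h, hg m m' h], max N N', fun m h => ?_⟩
    by_cases h1 : f m = 0
    · have : g m ≠ 0 := fun h2 => h (by simp [h1, h2])
      exact (hN' m this).trans (le_max_right _ _)
    · exact (hN m h1).trans (le_max_left _ _)
  smul_mem' := by
    rintro c f ⟨hf, N, hN⟩
    refine ⟨fun m m' h => by simp [hf m m' h], N, fun m h => hN m fun h1 => h (by simp [h1])⟩

open Classical in
/-- The colored monomial quasisymmetric function `M_I`: the sum of all monomials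
`x_{w_1,j_1} ⋯ x_{w_k,j_k}` with `j_1 < ⋯ < j_k`, that is, of all monomials with sentence `I`. -/
def M {A : Type u} (I : Sentence A) : QSym A :=
  ⟨fun m => if sentenceOf m = I then 1 else 0, fun m m' h => by simp [h],
    size I, fun m h => by
      by_cases h1 : sentenceOf m = I
      · simp [h1]
      · simp [h1] at h⟩

/-- The monomial `x_{w_1,1} x_{w_2,2} ⋯ x_{w_k,k}` of a sentence `(w_1, …, w_k)`. -/
def canon {A : Type u} (I : Sentence A) : Monomial A :=
  Finsupp.ofSupportFinite (fun i => FreeAddMonoid.ofList (wordAt I i.natPred)) (by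
    refine ((Finset.range I.length).image Nat.succPNat).finite_toSet.subset fun i hi => ?_
    simp only [Finset.coe_image, Set.mem_image, Finset.mem_coe, Finset.mem_range]
    refine ⟨i.natPred, ?_, by simp⟩
    by_contra hc
    refine hi ?_
    simp only [wordAt, List.getElem?_eq_none (not_lt.1 hc)]
    rfl)

theorem map_val_flattening {A : Type u} (W : List (List A)) (h : ∀ w ∈ W, w ≠ []) :
    (flattening W).map Subtype.val = W := by
  induction W with
  | nil => rfl
  | cons w W ih =>
    have ih' := ih fun v hv => h v (List.mem_cons_of_mem _ hv)
    cases w with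
    | nil => exact absurd rfl (h [] (by simp))
    | cons a l =>
      simp only [flattening, List.filterMap_cons, toWord, List.map_cons] at ih' ⊢
      rw [ih']

theorem map_val_sentenceOf {A : Type u} (m : Monomial A) :
    (sentenceOf m).map Subtype.val = (m.support.sort (· ≤ ·)).map fun i => (m i).toList := by
  refine map_val_flattening _ fun w hw => ?_
  obtain ⟨i, hi, rfl⟩ := List.mem_map.1 hw
  rw [Finset.mem_sort, Finsupp.mem_support_iff] at hi
  exact hi

theorem sentenceOf_canon {A : Type u} (I : Sentence A) : sentenceOf (canon I) = I := by
  apply List.map_injective_iff.2 Subtype.val_injective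
  rw [map_val_sentenceOf]
  have hs : (canon I).support = (Finset.range I.length).image Nat.succPNat := by
    ext i
    rw [Finsupp.mem_support_iff, Finset.mem_image]
    constructor
    · intro hi
      refine ⟨i.natPred, ?_, by simp⟩
      by_contra hc
      refine hi ?_
      change FreeAddMonoid.ofList (wordAt I i.natPred) = 0
      simp only [wordAt, List.getElem?_eq_none (not_lt.1 (Finset.mem_range.not.1 hc))]
      rfl
    · rintro ⟨r, hr, rfl⟩ h
      change wordAt I (r.succPNat).natPred = [] at h
      rw [Finset.mem_range] at hr
      simp only [Nat.natPred_succPNat, wordAt, List.getElem?_eq_getElem hr] at h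
      exact (I[r]).2 h
  have hl : (canon I).support.sort (· ≤ ·) = (List.range I.length).map Nat.succPNat := by
    rw [hs]
    have hp : ((List.range I.length).map Nat.succPNat).Pairwise (· < ·) := by
      rw [List.pairwise_map]
      exact List.pairwise_lt_range.imp fun h => Nat.succPNat_lt_succPNat.2 h
    have ht : (Finset.range I.length).image Nat.succPNat
        = ((List.range I.length).map Nat.succPNat).toFinset := by
      ext i; simp
    rw [ht]
    exact (List.toFinset_sort (· ≤ ·) (hp.imp fun h => h.ne)).2 (hp.imp fun h => h.le)
  rw [hl, List.map_map]
  apply List.ext_getElem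
  · simp
  · intro n h1 h2
    simp only [List.length_map, List.length_range] at h1
    simp only [List.getElem_map, List.getElem_range, Function.comp_apply]
    change wordAt I (n.succPNat).natPred = _
    simp [wordAt, h1]

open Classical in
/-- The colored monomial functions form a basis; the coordinate of `f` at `M_I` is the coefficient
of `x_{w_1,1} ⋯ x_{w_k,k}` in `f`. -/
def basisM (A : Type u) [Finite A] : Module.Basis (Sentence A) ℚ (QSym A) :=
  Module.Basis.ofRepr
    { toFun := fun f => Finsupp.ofSupportFinite (fun I => f.1 (canon I)) (by
        obtain ⟨N, hN⟩ := f.2.2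
        refine (finite_size_le N).subset fun I hI => ?_
        have := hN (canon I) hI
        rwa [sentenceOf_canon] at this)
      map_add' := fun f g => by ext I; rfl
      map_smul' := fun c f => by ext I; rfl
      invFun := fun c => ⟨fun m => c (sentenceOf m), fun m m' h => by simp only [h],
        c.support.sup size, fun m h => Finset.le_sup (f := size) (Finsupp.mem_support_iff.2 h)⟩
      left_inv := fun f => by
        ext m
        exact f.2.1 _ _ (sentenceOf_canon _)
      right_inv := fun c => by
        ext I
        change c (sentenceOf (canon I)) = c I
        rw [sentenceOf_canon] }

theorem basisM_apply {A : Type u} [Finite A] (I : Sentence A) : basisM A I = M I := by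
  classical
  apply (basisM A).repr.injective
  rw [Module.Basis.repr_self]
  ext J
  change _ = (if sentenceOf (canon J) = I then (1 : ℚ) else 0)
  rw [sentenceOf_canon, Finsupp.single_apply]
  simp [eq_comm]

/-- The colored fundamental quasisymmetric function `F_I = ∑_{J ⪯ I} M_J`. -/
def F {A : Type u} [Finite A] (I : Sentence A) : QSym A := ∑ J ∈ refinements I, M J

/-- The coproduct of the colored quasisymmetric functions: the linear map with
`Δ(M_I) = ∑_{I = J · K} M_J ⊗ M_K`. -/
def coproduct (A : Type u) [Finite A] : QSym A →ₗ[ℚ] QSym A ⊗[ℚ] QSym A :=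
  (basisM A).constr ℚ fun I =>
    ∑ i ∈ Finset.range (I.length + 1), M (I.take i) ⊗ₜ[ℚ] M (I.drop i)

/-! ### Colored immaculate tableaux -/

/-- The (active) boxes of the skew shape `I/J` as pairs (row, column), both numbered from `0`, in
reading order: from the bottom row to the top row, and from left to right within a row. -/
def boxes {A : Type u} (I J : Sentence A) : List (ℕ × ℕ) :=
  (List.range I.length).reverse.flatMap fun r =>
    (List.range' (wordAt J r).length ((wordAt I r).length - (wordAt J r).length)).map fun c => (r, c)

theorem mem_boxes {A : Type u} {I J : Sentence A} {p : ℕ × ℕ} :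
    p ∈ boxes I J ↔ (wordAt J p.1).length ≤ p.2 ∧ p.2 < (wordAt I p.1).length := by
  obtain ⟨r, c⟩ := p
  simp only [boxes, List.mem_flatMap, List.mem_reverse, List.mem_range, List.mem_map,
    List.mem_range'_1, Prod.mk.injEq]
  constructor
  · rintro ⟨r, _, c, h, rfl, rfl⟩
    omega
  · intro h
    refine ⟨r, ?_, c, by omega, rfl, rfl⟩
    by_contra hc
    simp [wordAt, List.getElem?_eq_none (not_lt.1 hc)] at h

/-- A box of the skew shape `I/J`. -/
abbrev Box {A : Type u} (I J : Sentence A) : Type := {p : ℕ × ℕ // p ∈ boxes I J}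

/-- The color of a box: the letter of `I` in that position. -/
def Box.color {A : Type u} {I J : Sentence A} (p : Box I J) : A :=
  (wordAt I p.1.1)[p.1.2]'(mem_boxes.1 p.2).2

instance {A : Type u} (I J : Sentence A) : Finite (Box I J) := (boxes I J).finite_toSet

/-- A skew colored immaculate tableau of shape `I/J`: positive integers in the boxes of `I/J`,
weakly increasing along rows, and strictly increasing from top to bottom in the first column
of `I`. -/
@[ext]
structure Tableau {A : Type u} (I J : Sentence A) where
  entry : Box I J → ℕ+
  row_weak : ∀ p q : Box I J, p.1.1 = q.1.1 → p.1.2 ≤ q.1.2 → entry p ≤ entry q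
  col_strict : ∀ p q : Box I J, p.1.2 = 0 → q.1.2 = 0 → p.1.1 < q.1.1 → entry p < entry q

/-- The `i`-th word of the type of a tableau: the colors of the boxes filled with `i`, read from
left to right and from bottom to top. -/
def Tableau.word {A : Type u} {I J : Sentence A} (T : Tableau I J) (i : ℕ+) : List A :=
  ((boxes I J).attach.filter fun p => T.entry p = i).map Box.color

/-- The monomial `x_T = x_{u_1,1} x_{u_2,2} ⋯` of a tableau of type `(u_1, u_2, …)`. -/
def Tableau.monomial {A : Type u} {I J : Sentence A} (T : Tableau I J) : Monomial A :=
  Finsupp.ofSupportFinite (fun i => FreeAddMonoid.ofList (T.word i)) (by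
    refine (Set.finite_range T.entry).subset fun i hi => ?_
    by_contra hc
    refine hi ?_
    have : T.word i = [] := by
      simp only [Tableau.word, List.map_eq_nil_iff, List.filter_eq_nil_iff, decide_eq_true_eq]
      exact fun p _ h => hc ⟨p, h⟩
    simp only [this]
    rfl)

theorem Tableau.entry_mem_support {A : Type u} {I J : Sentence A} (T : Tableau I J) (p : Box I J) :
    T.entry p ∈ T.monomial.support := by
  rw [Finsupp.mem_support_iff]
  intro h
  change T.word (T.entry p) = [] at h
  simp only [Tableau.word, List.map_eq_nil_iff, List.filter_eq_nil_iff, decide_eq_true_eq] at h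
  exact h p (List.mem_attach _ _) rfl

/-- Only finitely many tableaux of a given shape have a given monomial. -/
theorem Tableau.finite_monomial {A : Type u} (I J : Sentence A) (m : Monomial A) :
    Finite {T : Tableau I J // T.monomial = m} := by
  refine Finite.of_injective (β := Box I J → m.support)
    (fun T p => ⟨T.1.entry p, by
      have h := T.1.entry_mem_support p
      rwa [congrArg Finsupp.support T.2] at h⟩) ?_
  rintro ⟨T, hT⟩ ⟨T', hT'⟩ h
  apply Subtype.ext
  ext p : 2
  exact congrArg Subtype.val (congrFun h p)

/-- The formal power series `∑_T x_T`, over all skew colored immaculate tableaux `T` of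
shape `I/J`. -/
def tableauSeries {A : Type u} (I J : Sentence A) : Series A := fun m =>
  (Nat.card {T : Tableau I J // T.monomial = m} : ℚ)

theorem exists_relabel {A : Type u} {m m' : Monomial A} (h : sentenceOf m = sentenceOf m') :
    ∃ σ : m.support ≃o m'.support, ∀ i, m' (σ i) = m i := by
  have hL : (m.support.sort (· ≤ ·)).map (fun i => (m i).toList)
      = (m'.support.sort (· ≤ ·)).map fun i => (m' i).toList := by
    rw [← map_val_sentenceOf, ← map_val_sentenceOf, h]
  have hc : m.support.card = m'.support.card := by
    simpa using congrArg List.length hL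
  let e := m.support.orderIsoOfFin rfl
  let e' := m'.support.orderIsoOfFin hc.symm
  refine ⟨e.symm.trans e', fun i => ?_⟩
  obtain ⟨k, rfl⟩ := e.surjective i
  simp only [OrderIso.trans_apply, OrderIso.symm_apply_apply]
  have h1 : ((e k : m.support) : ℕ+) = (m.support.sort (· ≤ ·))[k.1]'(by simp) := by
    simp only [e, Finset.coe_orderIsoOfFin_apply, Finset.orderEmbOfFin_apply]
    rfl
  have h2 : ((e' k : m'.support) : ℕ+)
      = (m'.support.sort (· ≤ ·))[k.1]'(by rw [Finset.length_sort, ← hc]; exact k.2) := by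
    simp only [e', Finset.coe_orderIsoOfFin_apply, Finset.orderEmbOfFin_apply]
    rfl
  have h3 := List.getElem_of_eq hL (i := k.1) (by simp)
  rw [List.getElem_map, List.getElem_map, ← h1, ← h2] at h3
  exact h3.symm

theorem card_le_of_sentenceOf_eq {A : Type u} (I J : Sentence A) {m m' : Monomial A}
    (h : sentenceOf m = sentenceOf m') :
    Nat.card {T : Tableau I J // T.monomial = m} ≤
      Nat.card {T : Tableau I J // T.monomial = m'} := by
  obtain ⟨σ, hσ⟩ := exists_relabel h
  have := Tableau.finite_monomial I J m'
  have hmem : ∀ T : {T : Tableau I J // T.monomial = m}, ∀ p, T.1.entry p ∈ m.support := by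
    rintro ⟨T, rfl⟩ p
    exact T.entry_mem_support p
  let S : {T : Tableau I J // T.monomial = m} → Tableau I J := fun T =>
    { entry := fun p => σ ⟨T.1.entry p, hmem T p⟩
      row_weak := fun p q h1 h2 => σ.monotone (T.1.row_weak p q h1 h2)
      col_strict := fun p q h1 h2 h3 => σ.strictMono (T.1.col_strict p q h1 h2 h3) }
  have hS : ∀ T, (S T).monomial = m' := by
    intro T
    ext i
    change (S T).word i = m' i
    by_cases hi : i ∈ m'.support
    · obtain ⟨j, hj⟩ := σ.surjective ⟨i, hi⟩
      have hj' : i = σ j := by rw [hj]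
      have h1 : (S T).word i = T.1.word j := by
        simp only [Tableau.word]
        congr 2
        funext p
        have : (S T).entry p = σ ⟨T.1.entry p, hmem T p⟩ := rfl
        rw [this, hj']
        simp only [decide_eq_decide]
        rw [← Subtype.ext_iff, σ.injective.eq_iff, Subtype.ext_iff]
      rw [h1, hj', hσ]
      exact DFunLike.congr_fun T.2 j.1
    · rw [Finsupp.notMem_support_iff.1 hi]
      have : (S T).word i = [] := by
        simp only [Tableau.word, List.map_eq_nil_iff, List.filter_eq_nil_iff, decide_eq_true_eq]
        intro p _ hp
        exact hi (hp ▸ (σ ⟨T.1.entry p, hmem T p⟩).2)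
      exact this
  refine Nat.card_le_card_of_injective
    (fun T => (⟨S T, hS T⟩ : {T : Tableau I J // T.monomial = m'})) ?_
  intro T T' hTT
  apply Subtype.ext
  ext p : 2
  have h1 : (S T).entry p = (S T').entry p := by
    have h0 : S T = S T' := congrArg Subtype.val hTT
    rw [h0]
  have h2 := σ.injective (Subtype.ext h1)
  exact congrArg Subtype.val h2

theorem size_sentenceOf {A : Type u} (m : Monomial A) :
    size (sentenceOf m) = ∑ i ∈ m.support, (m i).length := by
  have h1 : size (sentenceOf m) = (((sentenceOf m).map Subtype.val).map List.length).sum := by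
    rw [size, List.map_map]; rfl
  rw [h1, map_val_sentenceOf, List.map_map, ← List.sum_toFinset _ (Finset.sort_nodup _ _),
    Finset.sort_toFinset]
  rfl

theorem sum_length_filter_le {β : Type*} (l : List β) (f : β → ℕ+) (S : Finset ℕ+) :
    ∑ i ∈ S, (l.filter fun p => f p = i).length ≤ l.length := by
  induction l with
  | nil => simp
  | cons a l ih =>
    have h1 : ∀ i, ((a :: l).filter fun p => f p = i).length
        = (if f a = i then 1 else 0) + (l.filter fun p => f p = i).length := by
      intro i
      by_cases h : f a = i <;> simp [h, add_comm]
    have h2 : (∑ i ∈ S, if f a = i then 1 else 0) ≤ 1 := by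
      rw [Finset.sum_ite_eq]; split_ifs <;> simp
    simp only [h1, Finset.sum_add_distrib, List.length_cons]
    omega

theorem tableauSeries_mem {A : Type u} (I J : Sentence A) : tableauSeries I J ∈ QSym A := by
  refine ⟨fun m m' h => ?_, (boxes I J).length, fun m h => ?_⟩
  · exact congrArg (Nat.cast : ℕ → ℚ) (le_antisymm (card_le_of_sentenceOf_eq I J h)
      (card_le_of_sentenceOf_eq I J h.symm))
  · have h1 : Nat.card {T : Tableau I J // T.monomial = m} ≠ 0 := fun h0 => h (by
      simp [tableauSeries, h0])
    obtain ⟨⟨T, rfl⟩⟩ := (Nat.card_ne_zero.1 h1).1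
    rw [size_sentenceOf]
    have h2 : ∀ i, (T.monomial i).length
        = ((boxes I J).attach.filter fun p => T.entry p = i).length := fun i => by
      change (T.word i).length = _
      rw [Tableau.word, List.length_map]
    simp only [h2]
    exact (sum_length_filter_le _ _ _).trans (by simp)

/-- The colored dual immaculate function `𝔖*_I`: the sum of `x_T` over all colored immaculate
tableaux of (straight) shape `I`. -/
def dualImmaculate {A : Type u} (I : Sentence A) : QSym A :=
  ⟨tableauSeries I [], tableauSeries_mem I []⟩

/-! ### Colored noncommutative symmetric functions -/

/-- The algebra of colored noncommutative symmetric functions: the algebra of sentences under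
concatenation, which is freely generated by the non-empty words. -/
abbrev NSym (A : Type u) : Type u := MonoidAlgebra ℚ (FreeMonoid (Word A))

/-- The colored complete homogeneous function `H_I`. -/
def H {A : Type u} (I : Sentence A) : NSym A := MonoidAlgebra.single (FreeMonoid.ofList I) 1

/-- The colored ribbon function `R_I = ∑_{J ⪰ I} (-1)^{ℓ(J) - ℓ(I)} H_J`. -/
def R {A : Type u} [Finite A] (I : Sentence A) : NSym A :=
  ∑ J ∈ coarsenings I, (-1 : ℚ) ^ ((J.length : ℤ) - (I.length : ℤ)) • H J

/-- The bilinear pairing with `⟨H_I, M_J⟩ = δ_{I,J}`: the coordinate of `g` at `M_I` is the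
coefficient of `x_{w_1,1} ⋯ x_{w_k,k}`, where `I = (w_1, …, w_k)`. -/
def pairing {A : Type u} (f : NSym A) (g : Series A) : ℚ :=
  f.coeff.sum fun I c => c * g (canon I.toList)

theorem pairing_H_M {A : Type u} [DecidableEq A] (I J : Sentence A) :
    pairing (H I) (M J).1 = if I = J then 1 else 0 := by
  simp only [pairing, H, MonoidAlgebra.coeff_single, M]
  rw [Finsupp.sum_single_index (by simp)]
  simp [sentenceOf_canon]

theorem size_sentenceOf_add {A : Type u} (p q : Monomial A) :
    size (sentenceOf (p + q)) = size (sentenceOf p) + size (sentenceOf q) := by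
  have h : ∀ m : Monomial A, size (sentenceOf m) = m.sum fun _ w => w.length := fun m => by
    rw [size_sentenceOf]; rfl
  simp only [h]
  exact Finsupp.sum_add_index' (fun _ => rfl) fun _ _ _ => FreeAddMonoid.length_add _ _

/-- The largest size of a sentence `I` such that `H_I` occurs in `f`. -/
def degree {A : Type u} (f : NSym A) : ℕ := f.coeff.support.sup fun I => size I.toList

theorem size_le_degree_of_pairing_ne_zero {A : Type u} (f : NSym A) (I : Sentence A)
    (g G : Series A) (hg : ∀ m, g m ≠ 0 → size I ≤ size (sentenceOf m))
    (h : pairing f (Series.mul g G) ≠ 0 ∨ pairing f (Series.mul G g) ≠ 0) :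
    size I ≤ degree f := by
  have key : ∀ k : Series A, pairing f k ≠ 0 →
      ∃ L ∈ f.coeff.support, k (canon L.toList) ≠ 0 := by
    intro k hk
    obtain ⟨L, hL, h1⟩ := Finset.exists_ne_zero_of_sum_ne_zero hk
    exact ⟨L, hL, right_ne_zero_of_mul h1⟩
  have fin : ∀ (L : FreeMonoid (Word A)) (p q : Monomial A), L ∈ f.coeff.support →
      p + q = canon L.toList → size (sentenceOf p) ≤ degree f ∧ size (sentenceOf q) ≤ degree f := by
    intro L p q hL hpq
    have h1 := size_sentenceOf_add p q
    rw [hpq, sentenceOf_canon] at h1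
    have h2 : size L.toList ≤ degree f :=
      Finset.le_sup (f := fun I : FreeMonoid (Word A) => size I.toList) hL
    omega
  rcases h with h | h
  · obtain ⟨L, hL, h1⟩ := key _ h
    obtain ⟨⟨p, q⟩, hp, h2⟩ := Finset.exists_ne_zero_of_sum_ne_zero h1
    rw [Set.Finite.mem_toFinset] at hp
    exact (hg p (left_ne_zero_of_mul h2)).trans (fin L p q hL hp).1
  · obtain ⟨L, hL, h1⟩ := key _ h
    obtain ⟨⟨p, q⟩, hp, h2⟩ := Finset.exists_ne_zero_of_sum_ne_zero h1
    rw [Set.Finite.mem_toFinset] at hp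
    exact (hg q (right_ne_zero_of_mul h2)).trans (fin L p q hL hp).2

theorem size_le_of_M_ne_zero {A : Type u} (I : Sentence A) (m : Monomial A) (h : (M I).1 m ≠ 0) :
    size I ≤ size (sentenceOf m) := by
  by_cases h1 : sentenceOf m = I
  · rw [h1]
  · simp [M, h1] at h

/-- The right perp operator `G^⊥`, adjoint to right multiplication by `G`:
`⟨G^⊥ f, g⟩ = ⟨f, g G⟩`, that is, `G^⊥ f = ∑_I ⟨f, M_I G⟩ H_I`. -/
def rightPerp {A : Type u} (G : Series A) (f : NSym A) : NSym A :=
  ∑ᶠ I : Sentence A, pairing f (Series.mul (M I).1 G) • H I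

/-- The sum in the definition of `rightPerp` is finite. -/
theorem rightPerp_finite {A : Type u} [Finite A] (G : Series A) (f : NSym A) :
    (Function.support fun I : Sentence A =>
      pairing f (Series.mul (M I).1 G) • H I).Finite := by
  refine (finite_size_le (degree f)).subset fun I hI => ?_
  exact size_le_degree_of_pairing_ne_zero f I _ G (size_le_of_M_ne_zero I)
    (Or.inl (left_ne_zero_of_smul hI))

/-- The defining adjunction of `rightPerp`. -/
theorem pairing_rightPerp {A : Type u} [Finite A] (G : Series A) (f : NSym A) (g : QSym A) :
    pairing (rightPerp G f) g.1 = pairing f (Series.mul g.1 G) := by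
  classical
  obtain ⟨N, hN⟩ := g.2.2
  let B := (finite_size_le (A := A) (max N (degree f))).toFinset
  have hf : rightPerp G f = ∑ I ∈ B, pairing f (Series.mul (M I).1 G) • H I := by
    refine finsum_eq_sum_of_support_subset _ fun I hI => ?_
    have : size I ≤ degree f :=
      size_le_degree_of_pairing_ne_zero f I _ G (size_le_of_M_ne_zero I)
        (Or.inl (left_ne_zero_of_smul hI))
    simp only [B, Set.Finite.coe_toFinset]
    exact this.trans (le_max_right _ _)
  have hadd : ∀ (a b : NSym A), pairing (a + b) g.1 = pairing a g.1 + pairing b g.1 := by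
    intro a b
    simp only [pairing, MonoidAlgebra.coeff_add]
    exact Finsupp.sum_add_index' (by simp) (by intros; ring)
  have hH : ∀ (c : ℚ) (I : Sentence A), pairing (c • H I) g.1 = c * g.1 (canon I) := by
    intro c I
    simp only [pairing, H, MonoidAlgebra.smul_single, MonoidAlgebra.coeff_single]
    rw [Finsupp.sum_single_index (by simp)]
    simp
  let P : NSym A →+ ℚ :=
    { toFun := fun a => pairing a g.1, map_zero' := by simp [pairing], map_add' := hadd }
  have h1 : pairing (rightPerp G f) g.1
      = ∑ I ∈ B, pairing f (Series.mul (M I).1 G) * g.1 (canon I) := by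
    rw [hf]
    change P _ = _
    rw [map_sum]
    exact Finset.sum_congr rfl fun I _ => hH _ I
  have hg : ∀ m, g.1 m = ∑ I ∈ B, g.1 (canon I) * (M I).1 m := by
    intro m
    by_cases hm : g.1 m = 0
    · rw [hm]
      refine (Finset.sum_eq_zero fun I _ => ?_).symm
      by_cases hI : sentenceOf m = I
      · rw [g.2.1 (canon I) m (by rw [sentenceOf_canon, hI]), hm, zero_mul]
      · simp [M, hI]
    · have hmem : sentenceOf m ∈ B := by
        simp only [B, Set.Finite.mem_toFinset]
        exact (hN m hm).trans (le_max_left _ _)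
      rw [Finset.sum_eq_single_of_mem _ hmem]
      · rw [g.2.1 (canon (sentenceOf m)) m (sentenceOf_canon _)]
        simp [M]
      · intro I _ hI
        simp [M, hI.symm]
  rw [h1]
  simp only [pairing, Finsupp.sum, Series.mul]
  simp only [Finset.sum_mul, Finset.mul_sum]
  rw [Finset.sum_comm]
  refine Finset.sum_congr rfl fun L _ => ?_
  rw [Finset.sum_comm]
  refine Finset.sum_congr rfl fun p _ => ?_
  rw [hg p.1, Finset.sum_mul, Finset.mul_sum]
  exact Finset.sum_congr rfl fun I _ => by ring

/-- The colored noncommutative Bernstein operator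
`𝔹_v = ∑_u ∑_{w(Q^r) = u} (-1)^{ℓ(Q)} H_{v · u} (∑_{Q ⪯ S} M_S^⊥)`; the double sum over `u` and
`Q` is a sum over all sentences `Q`, with `u = w(Q^r)`. -/
def bernstein {A : Type u} [Finite A] (v : Word A) (f : NSym A) : NSym A :=
  ∑ᶠ Q : Sentence A, (-1 : ℚ) ^ Q.length •
    (H [v.append (maxWord Q.reverse)] * ∑ S ∈ coarsenings Q, rightPerp (M S).1 f)

/-- The sum in the definition of `bernstein` is finite. -/
theorem bernstein_finite {A : Type u} [Finite A] (v : Word A) (f : NSym A) :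
    (Function.support fun Q : Sentence A => (-1 : ℚ) ^ Q.length •
      (H [v.append (maxWord Q.reverse)] *
        ∑ S ∈ coarsenings Q, rightPerp (M S).1 f)).Finite := by
  refine (finite_size_le (degree f)).subset fun Q hQ => ?_
  by_contra hc
  refine hQ ?_
  have h0 : ∑ S ∈ coarsenings Q, rightPerp (M S).1 f = 0 := by
    refine Finset.sum_eq_zero fun S hS => ?_
    have hSQ := (mem_coarsenings.1 hS).size_eq
    have : ∀ I : Sentence A, pairing f (Series.mul (M I).1 (M S).1) • H I = 0 := by
      intro I
      by_contra hI
      refine hc ?_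
      have := size_le_degree_of_pairing_ne_zero f S _ (M I).1 (size_le_of_M_ne_zero S)
        (Or.inr (left_ne_zero_of_smul hI))
      rw [hSQ] at this
      exact this
    simp [rightPerp, this]
  simp [h0]

/-- The colored immaculate function `𝔖_J = 𝔹_{v_1} 𝔹_{v_2} ⋯ 𝔹_{v_h}(1)`. -/
def immaculate {A : Type u} [Finite A] (J : Sentence A) : NSym A := J.foldr bernstein 1

/-- The skew colored dual immaculate function
`𝔖*_{I/J} = ∑_K ⟨𝔖_J H_K, 𝔖*_I⟩ M_K`, over all sentences `K` with `|K| = |I| - |J|`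
(for `J ⊆_L I`). -/
def skewDualImmaculate {A : Type u} [Finite A] (I J : Sentence A) : QSym A :=
  ∑ K ∈ sentences A (size I - size J), pairing (immaculate J * H K) (dualImmaculate I).1 • M K

end ColoredQSym

end

open ColoredQSym

/-!
The heart of the matter is the right Pieri rule `immaculate_mul_Hw`: for a word `u`, the product
`𝔖_J H_u` is the sum of all `𝔖_I` such that `I` arises from `J` by adding boxes at the ends of the
rows and at most one new row, where the letters of the new boxes, read from the bottom row to the
top row, form the word `u`. It follows by induction on the number of rows from the commutation
relation `bernstein_mul_Hw`,
`𝔹_v(f) H_u = ∑_{u = x · y} 𝔹_{v · y}(f H_x)`.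

To prove this relation, write `D_Q = ∑_{S ⪰ Q} M_S^⊥`. As the coproduct of `QSym_A` is
deconcatenation, there is the Leibniz rule
`M_{S · t}^⊥(f H_u) = M_{S · t}^⊥(f) H_u + [u = x · t] M_S^⊥(f) H_x`
(`rightPerp_M_concat_mul`), whose second term occurs only if the word `t` is a suffix of `u`. The
coarsenings of `Q · t` arise from the coarsenings of `Q` by appending `t` as a new word or by gluing
`t` to the last word, which gives the recursion `coarsePerp_concat_mul`,
`D_{Q · t}(f H_u) = D_{Q · t}(f) H_u + [u = x · t] D_Q(f H_x)`.
Inserting it in the definition of `𝔹_v(f H_u)`, the second terms assemble to the Bernstein operators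
`-𝔹_{v · t}(f H_x)`, since `w((Q · t)^r) = t · w(Q^r)`.

On the side of tableaux, the boxes of a skew tableau whose entry is not the largest one form a
smaller shape, and the removed boxes form exactly a strip as in the Pieri rule (`tabCount_concat`).
Hence `𝔖_J H_K` is the sum of all `𝔖_I`, each multiplied by the number of skew tableaux of shape
`I/J` and type `K` (`immaculate_mul_H`). For `J = ∅` this expands `H_K` in terms of immaculate functions,
so that these span `NSym_A`; a dimension count in bounded size shows that they form a basis, and the
coefficients in the expansion show that `𝔖*` is the dual basis (`immaculateBasis_repr`). Everything
else is the formalism of dual bases: `H, M`, `R, F` and `𝔖, 𝔖*` define the same canonical element in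
each degree, and the coproduct of `QSym_A` is dual to the product of `NSym_A`.
-/

noncomputable section

namespace ColoredQSym

universe u

/-! ### The basis of complete homogeneous functions -/

theorem H_mul_H {A : Type u} (I J : Sentence A) : H I * H J = H (I ++ J) := by
  simp [H, MonoidAlgebra.single_mul_single, FreeMonoid.ofList_append]

theorem H_nil {A : Type u} : (H [] : NSym A) = 1 := rfl

/-- The basis of complete homogeneous functions `H_I`. -/
def basisH (A : Type u) : Module.Basis (Sentence A) ℚ (NSym A) :=
  (MonoidAlgebra.basis (FreeMonoid (Word A)) ℚ).reindex FreeMonoid.toList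

theorem basisH_apply {A : Type u} (I : Sentence A) : basisH A I = H I := by
  simp [basisH, H]

/-- Linear maps out of `NSym A` are determined by their values at the functions `H_I`. -/
theorem linearMap_ext_H {A : Type u} {V : Type*} [AddCommMonoid V] [Module ℚ V]
    {φ ψ : NSym A →ₗ[ℚ] V} (h : ∀ I, φ (H I) = ψ (H I)) : φ = ψ :=
  (basisH A).ext fun I => by rw [basisH_apply, h]

/-- The pairing with a fixed power series as a linear functional. -/
def pairingL {A : Type u} (g : Series A) : NSym A →ₗ[ℚ] ℚ where
  toFun f := pairing f g
  map_add' a b := by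
    simp only [pairing, MonoidAlgebra.coeff_add]
    exact Finsupp.sum_add_index' (by simp) (by intros; ring)
  map_smul' c a := by
    simp only [pairing, MonoidAlgebra.coeff_smul, RingHom.id_apply, smul_eq_mul]
    rw [Finsupp.sum_smul_index (by simp), Finsupp.mul_sum]
    exact Finsupp.sum_congr fun _ _ => by ring

theorem pairingL_apply {A : Type u} (g : Series A) (f : NSym A) : pairingL g f = pairing f g := rfl

theorem pairing_H {A : Type u} (I : Sentence A) (g : Series A) : pairing (H I) g = g (canon I) := by
  simp only [pairing, H, MonoidAlgebra.coeff_single]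
  rw [Finsupp.sum_single_index (by simp)]
  simp

/-- A possibly empty word as a sentence with at most one word. -/
def ofWord {A : Type u} (u : List A) : Sentence A := flattening [u]

theorem ofWord_nil {A : Type u} : ofWord ([] : List A) = [] := rfl

theorem ofWord_val {A : Type u} (w : Word A) : ofWord w.1 = [w] := by
  obtain ⟨_ | ⟨a, l⟩, h⟩ := w
  · exact absurd rfl h
  · rfl

theorem ofWord_of_ne_nil {A : Type u} {u : List A} (h : u ≠ []) : ofWord u = [⟨u, h⟩] :=
  ofWord_val ⟨u, h⟩

theorem ofWord_injective {A : Type u} : Function.Injective (ofWord : List A → Sentence A) := by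
  rintro (_ | ⟨a, l⟩) (_ | ⟨b, m⟩) h
  · rfl
  · cases h
  · cases h
  · rw [ofWord_of_ne_nil (by simp), ofWord_of_ne_nil (by simp)] at h
    simpa using h

theorem append_ofWord_eq_nil {A : Type u} {S : Sentence A} {u : List A} :
    S ++ ofWord u = [] ↔ S = [] ∧ u = [] := by
  rw [List.append_eq_nil_iff, ← ofWord_nil, ofWord_injective.eq_iff]

theorem append_ofWord_eq_concat {A : Type u} {S T : Sentence A} {u : List A} {t : Word A} :
    S ++ ofWord u = T ++ [t] ↔ (u = [] ∧ S = T ++ [t]) ∨ (u = t.1 ∧ S = T) := by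
  by_cases hu : u = []
  · subst hu
    have : ([] : List A) ≠ t.1 := t.2.symm
    simp [ofWord_nil, this]
  · rw [ofWord_of_ne_nil hu]
    constructor
    · intro h
      obtain ⟨h1, h2⟩ := List.append_inj' h rfl
      exact Or.inr ⟨congrArg Subtype.val (List.singleton_injective h2), h1⟩
    · rintro (⟨h, -⟩ | ⟨rfl, rfl⟩)
      · exact absurd h hu
      · rfl

/-- The function `H_u` of a possibly empty word `u`, equal to `1` if `u` is empty. -/
def Hw {A : Type u} (u : List A) : NSym A := H (ofWord u)

theorem Hw_nil {A : Type u} : (Hw [] : NSym A) = 1 := rfl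

theorem Hw_val {A : Type u} (w : Word A) : Hw w.1 = H [w] := by rw [Hw, ofWord_val]

/-- Splitting off the last word, `H_I = H_{I'} H_w`. -/
theorem H_concat {A : Type u} (I : Sentence A) (w : Word A) : H (I ++ [w]) = H I * Hw w.1 := by
  rw [Hw_val, H_mul_H]

/-! ### Splittings of monomials -/

/-- The sentence of a monomial may be read off along any increasing list of indices that contains
the support. -/
theorem sentenceOf_eq_flattening {A : Type u} (m : Monomial A) (L : List ℕ+)
    (hL : L.Pairwise (· < ·)) (hm : ∀ i ∈ m.support, i ∈ L) :
    sentenceOf m = flattening (L.map fun i => (m i).toList) := by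
  classical
  have h1 : m.support.sort (· ≤ ·) = L.filter (· ∈ m.support) := by
    have hp : (L.filter (· ∈ m.support)).Pairwise (· < ·) := hL.filter _
    have : m.support = (L.filter (· ∈ m.support)).toFinset := by
      ext i
      simp only [List.mem_toFinset, List.mem_filter, decide_eq_true_eq]
      exact ⟨fun h => ⟨hm i h, h⟩, fun h => h.2⟩
    conv_lhs => rw [this]
    exact (List.toFinset_sort (· ≤ ·) (hp.imp fun h => h.ne)).2 (hp.imp fun h => h.le)
  rw [sentenceOf, h1]
  clear h1 hL hm
  induction L with
  | nil => rfl
  | cons i L ih =>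
    by_cases hi : i ∈ m.support
    · rw [List.filter_cons_of_pos (by simpa using hi)]
      simp only [flattening, List.map_cons, List.filterMap_cons] at ih ⊢
      rw [ih]
    · rw [List.filter_cons_of_neg (by simpa using hi), ih, List.map_cons,
        Finsupp.notMem_support_iff.1 hi]
      rfl

theorem flattening_append {A : Type u} (V W : List (List A)) :
    flattening (V ++ W) = flattening V ++ flattening W := List.filterMap_append

/-- The positive integers `1, …, n` in increasing order. -/
def indices (n : ℕ) : List ℕ+ := (List.range n).map Nat.succPNat

theorem indices_pairwise (n : ℕ) : (indices n).Pairwise (· < ·) := by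
  rw [indices, List.pairwise_map]
  exact List.pairwise_lt_range.imp fun h => Nat.succPNat_lt_succPNat.2 h

theorem mem_indices {n : ℕ} {i : ℕ+} : i ∈ indices n ↔ i < n.succPNat := by
  simp only [indices, List.mem_map, List.mem_range]
  constructor
  · rintro ⟨r, hr, rfl⟩
    exact Nat.succPNat_lt_succPNat.2 hr
  · intro h
    refine ⟨i.natPred, ?_, by simp⟩
    rw [← Nat.succPNat_lt_succPNat]
    simpa using h

theorem indices_succ (n : ℕ) : indices (n + 1) = indices n ++ [n.succPNat] := by
  simp [indices, List.range_succ]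

theorem lt_of_mem_support_canon {A : Type u} (I : Sentence A) :
    ∀ i ∈ (canon I).support, i < I.length.succPNat := by
  intro i hi
  by_contra hc
  refine Finsupp.mem_support_iff.1 hi ?_
  have h1 : I.length ≤ i.natPred := by
    rw [not_lt] at hc
    rw [← Nat.succPNat_le_succPNat]
    simpa using hc
  change FreeAddMonoid.ofList (wordAt I i.natPred) = 0
  simp only [wordAt, List.getElem?_eq_none h1]
  rfl

theorem canon_apply {A : Type u} (I : Sentence A) (i : ℕ+) :
    canon I i = FreeAddMonoid.ofList (wordAt I i.natPred) := rfl

theorem canon_concat {A : Type u} (I : Sentence A) (w : Word A) :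
    canon (I ++ [w]) = canon I + Finsupp.single I.length.succPNat (FreeAddMonoid.ofList w.1) := by
  ext i
  obtain ⟨r, rfl⟩ : ∃ r : ℕ, i = r.succPNat := ⟨i.natPred, by simp⟩
  rw [Finsupp.add_apply, canon_apply, canon_apply, Nat.natPred_succPNat]
  rcases lt_trichotomy r I.length with h | rfl | h
  · rw [Finsupp.single_eq_of_ne (fun h' => h.ne (Nat.succPNat_injective h')), add_zero]
    simp [wordAt, List.getElem?_append_left h]
  · simp [wordAt]
  · rw [Finsupp.single_eq_of_ne (fun h' => h.ne' (Nat.succPNat_injective h')), add_zero]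
    simp only [wordAt]
    rw [List.getElem?_eq_none (by simpa using h), List.getElem?_eq_none h.le]

theorem canon_nil {A : Type u} : canon ([] : Sentence A) = 0 := by
  ext i
  simp [canon_apply, wordAt]

theorem sentenceOf_zero {A : Type u} : sentenceOf (0 : Monomial A) = [] := by
  rw [← canon_nil, sentenceOf_canon]

/-- Multiplying a monomial by a word in a variable index larger than all others appends that word
to its sentence. -/
theorem sentenceOf_add_single {A : Type u} (m : Monomial A) (n : ℕ)
    (hm : ∀ i ∈ m.support, i < n.succPNat) (u : List A) :
    sentenceOf (m + Finsupp.single n.succPNat (FreeAddMonoid.ofList u)) =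
      sentenceOf m ++ ofWord u := by
  have h0 : m n.succPNat = 0 := by
    by_contra h
    exact lt_irrefl _ (hm _ (Finsupp.mem_support_iff.2 h))
  rw [sentenceOf_eq_flattening m (indices n) (indices_pairwise n)
      (fun i hi => mem_indices.2 (hm i hi)),
    sentenceOf_eq_flattening _ (indices (n + 1)) (indices_pairwise _), indices_succ,
    List.map_append, flattening_append, ofWord]
  · congr 2
    · refine List.map_congr_left fun i hi => ?_
      rw [Finsupp.add_apply, Finsupp.single_eq_of_ne (mem_indices.1 hi).ne, add_zero]
    · simp [h0]
  · intro i hi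
    rw [mem_indices]
    have h1 := Finsupp.support_add hi
    rw [Finset.mem_union] at h1
    rcases h1 with h | h
    · exact (hm i h).trans (Nat.succPNat_lt_succPNat.2 (Nat.lt_succ_self n))
    · have := Finsupp.support_single_subset h
      rw [Finset.mem_singleton] at this
      rw [this]
      exact Nat.succPNat_lt_succPNat.2 (Nat.lt_succ_self n)

/-- The finite set of factorizations of a monomial into two factors. -/
def splittings {A : Type u} (m : Monomial A) : Finset (Monomial A × Monomial A) :=
  (finite_splittings m).toFinset

theorem mem_splittings {A : Type u} {m : Monomial A} {p : Monomial A × Monomial A} :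
    p ∈ splittings m ↔ p.1 + p.2 = m := by simp [splittings]

/-- A factorization of `m · x_{u,n+1}`, where `m` only involves indices up to `n`, consists of a
factorization of `m` and a factorization of the word `u`. -/
theorem sum_splittings_add_single {A : Type u} {V : Type*} [AddCommMonoid V] (m : Monomial A)
    (n : ℕ) (hm : ∀ i ∈ m.support, i < n.succPNat) (u : List A)
    (φ : Monomial A × Monomial A → V) :
    ∑ p ∈ splittings (m + Finsupp.single n.succPNat (FreeAddMonoid.ofList u)), φ p =
      ∑ p ∈ splittings m, ∑ k ∈ Finset.range (u.length + 1),
        φ (p.1 + Finsupp.single n.succPNat (FreeAddMonoid.ofList (u.take k)),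
          p.2 + Finsupp.single n.succPNat (FreeAddMonoid.ofList (u.drop k))) := by
  have h0 : m n.succPNat = 0 := by
    by_contra h
    exact lt_irrefl _ (hm _ (Finsupp.mem_support_iff.2 h))
  have hz : ∀ p ∈ splittings m, p.1 n.succPNat = 0 ∧ p.2 n.succPNat = 0 := by
    intro p hp
    have h1 := DFunLike.congr_fun (mem_splittings.1 hp) n.succPNat
    rw [h0, Finsupp.add_apply] at h1
    exact List.append_eq_nil_iff.1 h1
  rw [← Finset.sum_product']
  symm
  refine Finset.sum_bij (fun x _ =>
    (x.1.1 + Finsupp.single n.succPNat (FreeAddMonoid.ofList (u.take x.2)),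
      x.1.2 + Finsupp.single n.succPNat (FreeAddMonoid.ofList (u.drop x.2)))) ?_ ?_ ?_ ?_
  · rintro ⟨⟨p, q⟩, k⟩ hx
    rw [Finset.mem_product] at hx
    obtain ⟨h1, h2⟩ := hz _ hx.1
    simp only at h1 h2
    rw [mem_splittings]
    ext i
    by_cases hi : i = n.succPNat
    · subst hi
      simp only [Finsupp.add_apply, Finsupp.single_eq_same, h1, h2, h0, zero_add]
      rw [← FreeAddMonoid.ofList_append, List.take_append_drop]
    · simp only [Finsupp.add_apply, Finsupp.single_eq_of_ne hi, add_zero]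
      exact DFunLike.congr_fun (mem_splittings.1 hx.1) i
  · rintro ⟨⟨p, q⟩, k⟩ hx ⟨⟨p', q'⟩, k'⟩ hx' h
    rw [Finset.mem_product, Finset.mem_range] at hx hx'
    obtain ⟨h1, h2⟩ := hz _ hx.1
    obtain ⟨h1', h2'⟩ := hz _ hx'.1
    simp only [Prod.mk.injEq] at h h1 h2 h1' h2' hx hx'
    have hk : u.take k = u.take k' := by
      have := DFunLike.congr_fun h.1 n.succPNat
      simpa [h1, h1'] using this
    have hk' : k = k' := by
      have := congrArg List.length hk
      simp only [List.length_take] at this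
      omega
    have hp : p = p' := by
      ext i
      by_cases hi : i = n.succPNat
      · rw [hi, h1, h1']
      · simpa [Finsupp.single_eq_of_ne hi] using DFunLike.congr_fun h.1 i
    have hq : q = q' := by
      ext i
      by_cases hi : i = n.succPNat
      · rw [hi, h2, h2']
      · simpa [Finsupp.single_eq_of_ne hi] using DFunLike.congr_fun h.2 i
    rw [hp, hq, hk']
  · rintro ⟨p, q⟩ hpq
    rw [mem_splittings] at hpq
    simp only at hpq
    have hu : (p n.succPNat).toList ++ (q n.succPNat).toList = u := by
      have := DFunLike.congr_fun hpq n.succPNat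
      simp only [Finsupp.add_apply, h0, zero_add, Finsupp.single_eq_same] at this
      exact this
    have ha : u.take (p n.succPNat).length = (p n.succPNat).toList := by
      rw [← hu]; exact List.take_left' rfl
    have hb : u.drop (p n.succPNat).length = (q n.succPNat).toList := by
      rw [← hu]; exact List.drop_left' rfl
    refine ⟨((p.erase n.succPNat, q.erase n.succPNat), (p n.succPNat).length), ?_, ?_⟩
    · rw [Finset.mem_product, mem_splittings, Finset.mem_range]
      constructor
      · ext i
        by_cases hi : i = n.succPNat
        · rw [hi, Finsupp.add_apply, Finsupp.erase_same, Finsupp.erase_same, h0, zero_add]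
        · rw [Finsupp.add_apply, Finsupp.erase_ne hi, Finsupp.erase_ne hi]
          have := DFunLike.congr_fun hpq i
          simpa [Finsupp.single_eq_of_ne hi] using this
      · have := congrArg List.length hu
        rw [List.length_append] at this
        change (p n.succPNat).toList.length < _
        omega
    · simp only [ha, hb, FreeAddMonoid.ofList_toList, Finsupp.erase_add_single]
  · intro _ _; rfl

/-! ### The adjoints of multiplication by monomial functions -/

/-- The operator `G^⊥` as a linear map. -/
def rightPerpL {A : Type u} [Finite A] (G : Series A) : NSym A →ₗ[ℚ] NSym A where
  toFun := rightPerp G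
  map_add' f g := by
    simp only [rightPerp, ← pairingL_apply, map_add, add_smul]
    exact finsum_add_distrib (rightPerp_finite G f) (rightPerp_finite G g)
  map_smul' c f := by
    simp only [rightPerp, ← pairingL_apply, map_smul, smul_assoc, RingHom.id_apply]
    exact (smul_finsum' c (rightPerp_finite G f)).symm

theorem rightPerpL_apply {A : Type u} [Finite A] (G : Series A) (f : NSym A) :
    rightPerpL G f = rightPerp G f := rfl

/-- The operator `M_S^⊥` sends `H_K` to the sum of all `H_I`, with `I` and `S` obtained by cutting
each word of `K` into two parts and removing empty parts. -/
theorem rightPerp_M_H {A : Type u} [Finite A] [DecidableEq A] (S K : Sentence A) :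
    rightPerp (M S).1 (H K) = ∑ p ∈ splittings (canon K),
      if sentenceOf p.2 = S then H (sentenceOf p.1) else 0 := by
  classical
  simp only [rightPerp, pairing_H, Series.mul, Finset.sum_smul]
  rw [finsum_sum_comm]
  · refine Finset.sum_congr rfl fun p _ => ?_
    rw [finsum_eq_single _ (sentenceOf p.1)]
    · simp [M]
    · intro I hI
      simp [M, hI.symm]
  · intro p _
    refine (Set.finite_singleton (sentenceOf p.1)).subset fun I hI => ?_
    by_contra hc
    exact hI (by simp [M, Ne.symm hc])

theorem lt_of_mem_support_splitting {A : Type u} {m : Monomial A} {n : ℕ}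
    (hm : ∀ i ∈ m.support, i < n.succPNat) {p : Monomial A × Monomial A} (hp : p ∈ splittings m) :
    (∀ i ∈ p.1.support, i < n.succPNat) ∧ ∀ i ∈ p.2.support, i < n.succPNat := by
  rw [mem_splittings] at hp
  subst hp
  have key : ∀ i, p.1 i ≠ 0 ∨ p.2 i ≠ 0 → i < n.succPNat := by
    intro i hi
    refine hm i (Finsupp.mem_support_iff.2 fun h => ?_)
    have := List.append_eq_nil_iff.1 h
    exact hi.elim (fun h => h this.1) fun h => h this.2
  exact ⟨fun i hi => key i (Or.inl (Finsupp.mem_support_iff.1 hi)),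
    fun i hi => key i (Or.inr (Finsupp.mem_support_iff.1 hi))⟩

/-- The recursion for `M_S^⊥` along the last word of `H_K`. -/
theorem rightPerp_M_H_concat {A : Type u} [Finite A] [DecidableEq A] (S K : Sentence A)
    (w : Word A) :
    rightPerp (M S).1 (H (K ++ [w])) = ∑ p ∈ splittings (canon K),
      ∑ k ∈ Finset.range (w.1.length + 1),
        if sentenceOf p.2 ++ ofWord (w.1.drop k) = S then
          H (sentenceOf p.1) * Hw (w.1.take k) else 0 := by
  rw [rightPerp_M_H, canon_concat, sum_splittings_add_single _ _ (lt_of_mem_support_canon K)]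
  refine Finset.sum_congr rfl fun p hp => Finset.sum_congr rfl fun k _ => ?_
  obtain ⟨h1, h2⟩ := lt_of_mem_support_splitting (lt_of_mem_support_canon K) hp
  simp only [sentenceOf_add_single _ _ h1, sentenceOf_add_single _ _ h2, Hw, H_mul_H]

/-- The operator `M_∅^⊥` commutes with right multiplications. -/
theorem rightPerp_M_nil_mul {A : Type u} [Finite A] (f : NSym A) (u : List A) :
    rightPerp (M []).1 (f * Hw u) = rightPerp (M []).1 f * Hw u := by
  classical
  by_cases hu : u = []
  · simp [hu, Hw_nil]
  change (rightPerpL (M []).1 ∘ₗ LinearMap.mulRight ℚ (Hw u)) f =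
    (LinearMap.mulRight ℚ (Hw u) ∘ₗ rightPerpL (M []).1) f
  congr 1
  refine linearMap_ext_H fun K => ?_
  simp only [LinearMap.comp_apply, LinearMap.mulRight_apply, rightPerpL_apply]
  rw [← H_concat K ⟨u, hu⟩, rightPerp_M_H_concat, rightPerp_M_H, Finset.sum_mul]
  refine Finset.sum_congr rfl fun p _ => ?_
  rw [Finset.sum_range_succ, Finset.sum_eq_zero]
  · simp [ofWord_nil]
  · intro k hk
    rw [if_neg]
    rw [append_ofWord_eq_nil, List.drop_eq_nil_iff]
    rw [Finset.mem_range] at hk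
    omega

/-- The Leibniz rule for `M_{S·t}^⊥`: the last word `t` of the sentence is removed either from `f`
or from the right factor `H_u`; the latter is possible if `t` is a suffix of `u`. -/
theorem rightPerp_M_concat_mul_sum {A : Type u} [Finite A] [DecidableEq A] (f : NSym A) (u : List A)
    (S : Sentence A) (t : Word A) :
    rightPerp (M (S ++ [t])).1 (f * Hw u) = rightPerp (M (S ++ [t])).1 f * Hw u +
      ∑ k ∈ Finset.range u.length,
        if u.drop k = t.1 then rightPerp (M S).1 f * Hw (u.take k) else 0 := by
  by_cases hu : u = []
  · simp [hu, Hw_nil]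
  let φ : ℕ → NSym A →ₗ[ℚ] NSym A := fun k =>
    if u.drop k = t.1 then LinearMap.mulRight ℚ (Hw (u.take k)) ∘ₗ rightPerpL (M S).1 else 0
  have hφ : ∀ k g, φ k g =
      if u.drop k = t.1 then rightPerp (M S).1 g * Hw (u.take k) else 0 := by
    intro k g
    simp only [φ]
    split_ifs <;> rfl
  simp only [← hφ]
  rw [← LinearMap.sum_apply]
  change (rightPerpL (M (S ++ [t])).1 ∘ₗ LinearMap.mulRight ℚ (Hw u)) f =
    (LinearMap.mulRight ℚ (Hw u) ∘ₗ rightPerpL (M (S ++ [t])).1 +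
      ∑ k ∈ Finset.range u.length, φ k) f
  congr 1
  refine linearMap_ext_H fun K => ?_
  simp only [LinearMap.comp_apply, LinearMap.mulRight_apply, rightPerpL_apply, LinearMap.add_apply,
    LinearMap.sum_apply, hφ]
  rw [← H_concat K ⟨u, hu⟩, rightPerp_M_H_concat, rightPerp_M_H, rightPerp_M_H, Finset.sum_mul]
  have h1 : ∀ k, (if u.drop k = t.1 then (∑ p ∈ splittings (canon K),
      if sentenceOf p.2 = S then H (sentenceOf p.1) else 0) * Hw (u.take k) else 0) =
      ∑ p ∈ splittings (canon K), if u.drop k = t.1 ∧ sentenceOf p.2 = S then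
        H (sentenceOf p.1) * Hw (u.take k) else 0 := by
    intro k
    by_cases h : u.drop k = t.1 <;> simp [h, Finset.sum_mul]
  simp only [h1]
  rw [Finset.sum_comm (s := Finset.range u.length), ← Finset.sum_add_distrib]
  refine Finset.sum_congr rfl fun p _ => ?_
  rw [Finset.sum_range_succ, add_comm]
  congr 1
  · simp [ofWord_nil]
  · refine Finset.sum_congr rfl fun k hk => ?_
    have h2 : u.drop k ≠ [] := by
      rw [Finset.mem_range] at hk
      rw [Ne, List.drop_eq_nil_iff]
      omega
    simp only [append_ofWord_eq_concat, h2, false_and, false_or]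

/-! ### Coarsenings and the last word -/

theorem Word.append_append {A : Type u} (v : Word A) (s t : List A) :
    (v.append s).append t = v.append (s ++ t) := by
  simp [Word.append]

theorem Word.append_nil {A : Type u} (v : Word A) : v.append [] = v := by
  simp [Word.append]

theorem Refines.concat {A : Type u} {I J : Sentence A} (h : Refines I J) (t : Word A) :
    Refines (I ++ [t]) (J ++ [t]) := by
  induction h with
  | nil => exact .keep t .nil
  | keep w _ ih => exact .keep w ih
  | glue w v _ ih => exact .glue w v ih

theorem Refines.concat_glue {A : Type u} {I J : Sentence A} (h : Refines I J) (t : Word A)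
    {S : Sentence A} {s : Word A} (hJ : J = S ++ [s]) :
    Refines (I ++ [t]) (S ++ [s.append t.1]) := by
  induction h generalizing S s with
  | nil => simp at hJ
  | @keep w I J h ih =>
    cases S with
    | nil =>
      obtain ⟨rfl, rfl⟩ : w = s ∧ J = [] := by simpa using hJ
      exact .glue w t (h.concat t)
    | cons x S =>
      obtain ⟨rfl, rfl⟩ : w = x ∧ J = S ++ [s] := by simpa using hJ
      exact .keep w (ih rfl)
  | @glue w v I J h ih =>
    cases S with
    | nil =>
      obtain ⟨rfl, rfl⟩ : w.append v.1 = s ∧ J = [] := by simpa using hJ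
      rw [Word.append_append]
      exact .glue w (v.append t.1) (ih (S := []) (s := v) rfl)
    | cons x S =>
      obtain ⟨rfl, rfl⟩ : w.append v.1 = x ∧ J = S ++ [s] := by simpa using hJ
      exact .glue w v (ih (S := v :: S) rfl)

theorem Refines.eq_nil_iff {A : Type u} {I J : Sentence A} (h : Refines I J) :
    I = [] ↔ J = [] := by
  cases h <;> simp

/-- The last word of a sentence that is refined by `Q · t` is either `t` itself, or `t` is glued to
the last word of a sentence refined by `Q`. -/
theorem refines_concat {A : Type u} {Q S : Sentence A} {t : Word A} :
    Refines (Q ++ [t]) S ↔ ∃ S', Refines Q S' ∧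
      (S = S' ++ [t] ∨ ∃ S'' s, S' = S'' ++ [s] ∧ S = S'' ++ [s.append t.1]) := by
  constructor
  · intro h
    induction Q generalizing S with
    | nil =>
      cases h with
      | keep _ h =>
        cases h
        exact ⟨[], .nil, Or.inl rfl⟩
      | glue _ v h => cases h
    | cons w Q ih =>
      cases h with
      | keep _ h =>
        obtain ⟨S', h1, rfl | ⟨S'', s, rfl, rfl⟩⟩ := ih h
        · exact ⟨w :: S', .keep w h1, Or.inl rfl⟩
        · exact ⟨w :: (S'' ++ [s]), .keep w h1, Or.inr ⟨w :: S'', s, rfl, rfl⟩⟩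
      | @glue _ v _ J h =>
        obtain ⟨S', h1, h2 | ⟨S'', s, rfl, h2⟩⟩ := ih h
        · cases S' with
          | nil =>
            obtain ⟨rfl, rfl⟩ : v = t ∧ J = [] := by simpa using h2
            exact ⟨[w], .keep w h1, Or.inr ⟨[], w, rfl, rfl⟩⟩
          | cons x S' =>
            obtain ⟨rfl, rfl⟩ : v = x ∧ J = S' ++ [t] := by simpa using h2
            exact ⟨w.append v.1 :: S', .glue w v h1, Or.inl rfl⟩
        · cases S'' with
          | nil =>
            obtain ⟨rfl, rfl⟩ : v = s.append t.1 ∧ J = [] := by simpa using h2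
            refine ⟨[w.append s.1], .glue w s h1, Or.inr ⟨[], w.append s.1, rfl, ?_⟩⟩
            rw [Word.append_append]
            rfl
          | cons x S'' =>
            obtain ⟨rfl, rfl⟩ : v = x ∧ J = S'' ++ [s.append t.1] := by simpa using h2
            exact ⟨w.append v.1 :: (S'' ++ [s]), .glue w v h1,
              Or.inr ⟨w.append v.1 :: S'', s, rfl, rfl⟩⟩
  · rintro ⟨S', h, rfl | ⟨S'', s, rfl, rfl⟩⟩
    · exact h.concat t
    · exact h.concat_glue t rfl

/-- Glue a word to the last word of a sentence (the empty sentence is left unchanged). -/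
def glueLast {A : Type u} (S : Sentence A) (t : List A) : Sentence A :=
  S.dropLast ++ (S.getLast?.map fun s => s.append t).toList

theorem glueLast_concat {A : Type u} (S : Sentence A) (s : Word A) (t : List A) :
    glueLast (S ++ [s]) t = S ++ [s.append t] := by
  simp [glueLast]

theorem coarsenings_nil {A : Type u} [Finite A] :
    coarsenings ([] : Sentence A) = {[]} := by
  ext S
  rw [mem_coarsenings, Finset.mem_singleton]
  constructor
  · intro h
    exact h.eq_nil_iff.1 rfl
  · rintro rfl
    exact .nil

theorem sum_coarsenings_concat {A : Type u} [Finite A] [DecidableEq A] {V : Type*}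
    [AddCommMonoid V] (Q : Sentence A) (t : Word A) (g : Sentence A → V) :
    ∑ S ∈ coarsenings (Q ++ [t]), g S =
      ∑ S ∈ coarsenings Q, (g (S ++ [t]) + if S = [] then 0 else g (glueLast S t.1)) := by
  have h1 : coarsenings (Q ++ [t]) = (coarsenings Q).image (· ++ [t]) ∪
      ((coarsenings Q).filter (¬ · = [])).image (glueLast · t.1) := by
    ext S
    simp only [mem_coarsenings, refines_concat, Finset.mem_union, Finset.mem_image,
      Finset.mem_filter]
    constructor
    · rintro ⟨S', h, rfl | ⟨S'', s, rfl, rfl⟩⟩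
      · exact Or.inl ⟨S', h, rfl⟩
      · exact Or.inr ⟨_, ⟨h, by simp⟩, glueLast_concat _ _ _⟩
    · rintro (⟨S', h, rfl⟩ | ⟨S', ⟨h, h'⟩, rfl⟩)
      · exact ⟨S', h, Or.inl rfl⟩
      · obtain ⟨S'', s, rfl⟩ := List.eq_nil_or_concat' S' |>.resolve_left h'
        exact ⟨_, h, Or.inr ⟨S'', s, rfl, glueLast_concat _ _ _⟩⟩
  have h2 : Disjoint ((coarsenings Q).image (· ++ [t]))
      (((coarsenings Q).filter (¬ · = [])).image (glueLast · t.1)) := by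
    rw [Finset.disjoint_left]
    intro S hS hS'
    rw [Finset.mem_image] at hS hS'
    obtain ⟨T, -, rfl⟩ := hS
    obtain ⟨T', hT', h⟩ := hS'
    obtain ⟨T'', s, rfl⟩ := List.eq_nil_or_concat' T' |>.resolve_left (Finset.mem_filter.1 hT').2
    rw [glueLast_concat] at h
    have h3 := congrArg Subtype.val (List.singleton_injective (List.append_inj' h rfl).2)
    exact s.2 (List.append_left_eq_self.1 h3)
  have h3 : Set.InjOn (glueLast · t.1) ((coarsenings Q).filter (¬ · = []) : Set (Sentence A)) := by
    intro S hS S' hS' h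
    simp only [Finset.coe_filter, Set.mem_ofPred_eq] at hS hS'
    obtain ⟨T, s, rfl⟩ := List.eq_nil_or_concat' S |>.resolve_left hS.2
    obtain ⟨T', s', rfl⟩ := List.eq_nil_or_concat' S' |>.resolve_left hS'.2
    simp only [glueLast_concat] at h
    obtain ⟨rfl, h4⟩ := List.append_inj' h rfl
    have h5 := congrArg Subtype.val (List.singleton_injective h4)
    simp only [Word.append, List.append_left_inj] at h5
    rw [Subtype.ext h5]
  rw [h1, Finset.sum_union h2, Finset.sum_image (fun _ _ _ _ h => List.append_left_injective _ h),
    Finset.sum_image h3, Finset.sum_filter, ← Finset.sum_add_distrib]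
  refine Finset.sum_congr rfl fun S _ => ?_
  by_cases hS : S = [] <;> simp [hS]

/-! ### The Bernstein operators and right multiplication -/

/-- The operator `∑_{S ⪰ Q} M_S^⊥`. -/
def coarsePerp {A : Type u} [Finite A] (Q : Sentence A) (f : NSym A) : NSym A :=
  ∑ S ∈ coarsenings Q, rightPerp (M S).1 f

/-- A sum over all suffixes of `u` that are equal to `t` has at most one term. -/
theorem sum_drop_eq {A : Type u} [DecidableEq A] {V : Type*} [AddCommMonoid V] (u : List A)
    (t : List A) (ht : t ≠ []) (φ : List A → V) :
    (∑ k ∈ Finset.range u.length, if u.drop k = t then φ (u.take k) else 0) =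
      if t <:+ u then φ (u.take (u.length - t.length)) else 0 := by
  split_ifs with h
  · obtain ⟨x, rfl⟩ := h
    have ht' := List.length_pos_iff.2 ht
    rw [Finset.sum_eq_single x.length]
    · simp
    · intro k hk hkx
      rw [if_neg]
      intro h
      have h1 := congrArg List.length h
      simp only [List.length_append, List.length_drop] at h1
      simp only [Finset.mem_range, List.length_append] at hk
      omega
    · intro h
      simp only [List.length_append, Finset.mem_range] at h
      omega
  · refine Finset.sum_eq_zero fun k _ => if_neg ?_
    rintro rfl
    exact h (List.drop_suffix k u)

theorem rightPerp_M_concat_mul {A : Type u} [Finite A] [DecidableEq A] (f : NSym A) (u : List A)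
    (S : Sentence A) (t : Word A) :
    rightPerp (M (S ++ [t])).1 (f * Hw u) = rightPerp (M (S ++ [t])).1 f * Hw u +
      if t.1 <:+ u then rightPerp (M S).1 f * Hw (u.take (u.length - t.1.length)) else 0 := by
  rw [rightPerp_M_concat_mul_sum, sum_drop_eq u t.1 t.2 fun x => rightPerp (M S).1 f * Hw x]

/-- The Leibniz rule for `∑_{S ⪰ Q · t} M_S^⊥`. -/
theorem coarsePerp_concat_mul {A : Type u} [Finite A] [DecidableEq A] (f : NSym A) (u : List A)
    (Q : Sentence A) (t : Word A) :
    coarsePerp (Q ++ [t]) (f * Hw u) = coarsePerp (Q ++ [t]) f * Hw u +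
      if t.1 <:+ u then coarsePerp Q (f * Hw (u.take (u.length - t.1.length))) else 0 := by
  have h1 : (if t.1 <:+ u then coarsePerp Q (f * Hw (u.take (u.length - t.1.length))) else 0) =
      ∑ S ∈ coarsenings Q, if t.1 <:+ u then
        rightPerp (M S).1 (f * Hw (u.take (u.length - t.1.length))) else 0 := by
    split_ifs
    · rfl
    · simp
  rw [h1]
  simp only [coarsePerp, sum_coarsenings_concat, Finset.sum_mul]
  rw [← Finset.sum_add_distrib]
  refine Finset.sum_congr rfl fun S _ => ?_
  -- gluing `t` to the last word `s` of `S` removes `s · t` from `u`, which amounts to removing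
  -- first `t` and then `s`
  rcases List.eq_nil_or_concat' S with rfl | ⟨S, s, rfl⟩
  · simp only [if_true, add_zero, rightPerp_M_concat_mul, rightPerp_M_nil_mul]
  · simp only [List.append_eq_nil_iff, List.cons_ne_nil, and_false, if_false, glueLast_concat]
    rw [rightPerp_M_concat_mul f u (S ++ [s]) t, rightPerp_M_concat_mul f u S (s.append t.1),
      rightPerp_M_concat_mul f _ S s, add_mul]
    by_cases ht : t.1 <:+ u
    · obtain ⟨x, rfl⟩ := ht
      have h2 : (s.append t.1).1 <:+ x ++ t.1 ↔ s.1 <:+ x := by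
        constructor
        · rintro ⟨y, h⟩
          simp only [Word.append, ← List.append_assoc, List.append_left_inj] at h
          exact ⟨y, h⟩
        · rintro ⟨y, rfl⟩
          exact ⟨y, by simp [Word.append]⟩
      have h3 : (x ++ t.1).take ((x ++ t.1).length - t.1.length) = x := by simp
      have h4 : (x ++ t.1).take ((x ++ t.1).length - (s.append t.1).1.length) =
          x.take (x.length - s.1.length) := by
        simp only [Word.append, List.length_append]
        rw [Nat.add_sub_add_right, List.take_append_of_le_length (by omega)]
      rw [if_pos (List.suffix_append _ _), if_pos (List.suffix_append _ _), h3, h4]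
      simp only [h2]
      abel
    · have h2 : ¬ (s.append t.1).1 <:+ u := fun h => ht ((List.suffix_append s.1 t.1).trans h)
      simp [ht, h2]

/-- The summand of `𝔹_v(f)` at the sentence `Q`. -/
def bernsteinTerm {A : Type u} [Finite A] (v : Word A) (f : NSym A) (Q : Sentence A) : NSym A :=
  (-1 : ℚ) ^ Q.length • (H [v.append (maxWord Q.reverse)] * coarsePerp Q f)

theorem bernstein_eq_finsum {A : Type u} [Finite A] (v : Word A) (f : NSym A) :
    bernstein v f = ∑ᶠ Q, bernsteinTerm v f Q := rfl

theorem bernsteinTerm_finite {A : Type u} [Finite A] (v : Word A) (f : NSym A) :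
    (Function.support (bernsteinTerm v f)).Finite := bernstein_finite v f

theorem maxWord_reverse_concat {A : Type u} (Q : Sentence A) (t : Word A) :
    maxWord (Q ++ [t]).reverse = t.1 ++ maxWord Q.reverse := by
  simp [maxWord]

theorem bernsteinTerm_nil_mul {A : Type u} [Finite A] (v : Word A) (f : NSym A) (u : List A) :
    bernsteinTerm v (f * Hw u) [] = bernsteinTerm v f [] * Hw u := by
  simp [bernsteinTerm, coarsePerp, coarsenings_nil, rightPerp_M_nil_mul, mul_assoc]

theorem bernsteinTerm_concat_mul {A : Type u} [Finite A] [DecidableEq A] (v : Word A) (f : NSym A)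
    (u : List A) (Q : Sentence A) (t : Word A) :
    bernsteinTerm v (f * Hw u) (Q ++ [t]) = bernsteinTerm v f (Q ++ [t]) * Hw u -
      ∑ k ∈ Finset.range u.length, if u.drop k = t.1 then
        bernsteinTerm (v.append (u.drop k)) (f * Hw (u.take k)) Q else 0 := by
  have h1 : (∑ k ∈ Finset.range u.length, if u.drop k = t.1 then
      bernsteinTerm (v.append (u.drop k)) (f * Hw (u.take k)) Q else 0) =
      ∑ k ∈ Finset.range u.length, if u.drop k = t.1 then
        bernsteinTerm (v.append t.1) (f * Hw (u.take k)) Q else 0 := by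
    refine Finset.sum_congr rfl fun k _ => ?_
    split_ifs with h
    · rw [h]
    · rfl
  rw [h1, sum_drop_eq u t.1 t.2 fun x => bernsteinTerm (v.append t.1) (f * Hw x) Q]
  simp only [bernsteinTerm, coarsePerp_concat_mul, maxWord_reverse_concat, Word.append_append,
    List.length_append, List.length_singleton, pow_succ]
  split_ifs
  · rw [mul_add, smul_add, smul_mul_assoc, mul_assoc, mul_neg, mul_one, neg_smul, neg_smul,
      sub_eq_add_neg]
  · simp [mul_assoc]

/-- The commutation relation of Bernstein operators and right multiplication by a complete
homogeneous function. All terms with a non-trivial contribution of `H_u` to the Leibniz rule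
assemble to Bernstein operators for longer words. -/
theorem bernstein_mul_Hw {A : Type u} [Finite A] (v : Word A) (f : NSym A) (u : List A) :
    bernstein v f * Hw u =
      ∑ k ∈ Finset.range (u.length + 1), bernstein (v.append (u.drop k)) (f * Hw (u.take k)) := by
  classical
  rw [Finset.sum_range_succ, List.drop_length, List.take_length, Word.append_nil,
    ← sub_eq_iff_eq_add]
  -- the contributions of the suffix of `u` starting in position `k`
  let G : ℕ → Sentence A → NSym A := fun k Q =>
    if Q.getLast?.map Subtype.val = some (u.drop k) then
      bernsteinTerm (v.append (u.drop k)) (f * Hw (u.take k)) Q.dropLast else 0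
  have hG : ∀ k Q t, G k (Q ++ [t]) = if u.drop k = t.1 then
      bernsteinTerm (v.append (u.drop k)) (f * Hw (u.take k)) Q else 0 := by
    intro k Q t
    simp [G, eq_comm]
  have hG0 : ∀ k, G k [] = 0 := fun k => by simp [G]
  have hterm : ∀ Q, bernsteinTerm v (f * Hw u) Q =
      bernsteinTerm v f Q * Hw u - ∑ k ∈ Finset.range u.length, G k Q := by
    intro Q
    rcases List.eq_nil_or_concat' Q with rfl | ⟨Q, t, rfl⟩
    · simp only [hG0, Finset.sum_const_zero, sub_zero, bernsteinTerm_nil_mul]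
    · rw [bernsteinTerm_concat_mul]
      simp only [hG]
  have hsupp : ∀ k ∈ Finset.range u.length, (Function.support (G k)).Finite ∧
      ∑ᶠ Q, G k Q = bernstein (v.append (u.drop k)) (f * Hw (u.take k)) := by
    intro k hk
    have hne : u.drop k ≠ [] := by
      rw [Finset.mem_range] at hk
      rw [Ne, List.drop_eq_nil_iff]
      omega
    let t : Word A := ⟨u.drop k, hne⟩
    have hsub : Function.support (G k) ⊆ Set.range (fun Q : Sentence A => Q ++ [t]) := by
      intro Q hQ
      rcases List.eq_nil_or_concat' Q with rfl | ⟨Q, s, rfl⟩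
      · exact absurd (hG0 k) hQ
      · have : u.drop k = s.1 := by
          by_contra hc
          exact hQ (by rw [hG, if_neg hc])
        exact ⟨Q, by rw [show t = s from Subtype.ext this]⟩
    have hval : ∀ Q, G k (Q ++ [t]) =
        bernsteinTerm (v.append (u.drop k)) (f * Hw (u.take k)) Q := by
      intro Q
      rw [hG, if_pos rfl]
    constructor
    · refine ((bernsteinTerm_finite (v.append (u.drop k)) (f * Hw (u.take k))).image
        (fun Q : Sentence A => Q ++ [t])).subset fun Q hQ => ?_
      obtain ⟨Q, rfl⟩ := hsub hQ
      refine ⟨Q, ?_, rfl⟩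
      rw [Function.mem_support, ← hval]
      exact hQ
    · rw [bernstein_eq_finsum, ← finsum_mem_univ, ← finsum_mem_inter_support, Set.univ_inter,
        ← Set.inter_eq_right.2 hsub, finsum_mem_inter_support, finsum_mem_range
          (fun _ _ h => List.append_left_injective _ h)]
      exact finsum_congr hval
  have hmul : (bernstein v f) * Hw u = ∑ᶠ Q, bernsteinTerm v f Q * Hw u := by
    rw [bernstein_eq_finsum]
    exact finsum_mul' _ _ (bernsteinTerm_finite v f)
  have hfin : (Function.support fun Q => bernsteinTerm v f Q * Hw u).Finite :=
    (bernsteinTerm_finite v f).subset fun Q hQ h => hQ (by simp [h])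
  rw [← Finset.sum_congr rfl fun k hk => (hsupp k hk).2, hmul, bernstein_eq_finsum,
    ← finsum_sum_comm _ _ fun k hk => (hsupp k hk).1, sub_eq_iff_eq_add]
  have hfin2 : (Function.support fun Q => ∑ k ∈ Finset.range u.length, G k Q).Finite := by
    refine (Set.Finite.biUnion (Finset.range u.length).finite_toSet
      fun k hk => (hsupp k hk).1).subset fun Q hQ => ?_
    obtain ⟨k, hk, h⟩ := Finset.exists_ne_zero_of_sum_ne_zero hQ
    exact Set.mem_biUnion hk h
  rw [add_comm, ← finsum_add_distrib (bernsteinTerm_finite _ _) hfin2]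
  refine finsum_congr fun Q => ?_
  rw [hterm, sub_add_cancel]

theorem rightPerp_M_one {A : Type u} [Finite A] [DecidableEq A] (S : Sentence A) :
    rightPerp (M S).1 1 = if S = [] then 1 else 0 := by
  have h : splittings (0 : Monomial A) = {(0, 0)} := by
    ext p
    rw [mem_splittings, Finset.mem_singleton, Prod.ext_iff]
    constructor
    · intro h
      have h' : ∀ i, p.1 i = 0 ∧ p.2 i = 0 := fun i =>
        List.append_eq_nil_iff.1 (DFunLike.congr_fun h i)
      exact ⟨Finsupp.ext fun i => (h' i).1, Finsupp.ext fun i => (h' i).2⟩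
    · rintro ⟨h1, h2⟩
      rw [h1, h2, add_zero]
  rw [← H_nil, rightPerp_M_H, canon_nil, h, Finset.sum_singleton]
  simp only [sentenceOf_zero, eq_comm]

theorem bernstein_one {A : Type u} [Finite A] (v : Word A) : bernstein v 1 = H [v] := by
  classical
  rw [bernstein_eq_finsum, finsum_eq_single _ []]
  · simp [bernsteinTerm, coarsePerp, coarsenings_nil, rightPerp_M_one, maxWord, Word.append_nil]
  · intro Q hQ
    have : coarsePerp Q (1 : NSym A) = 0 := by
      refine Finset.sum_eq_zero fun S hS => ?_
      rw [rightPerp_M_one, if_neg]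
      exact fun h => hQ ((mem_coarsenings.1 hS).eq_nil_iff.2 h)
    simp [bernsteinTerm, this]

theorem immaculate_nil {A : Type u} [Finite A] : immaculate ([] : Sentence A) = 1 := rfl

theorem immaculate_cons {A : Type u} [Finite A] (v : Word A) (J : Sentence A) :
    immaculate (v :: J) = bernstein v (immaculate J) := rfl

theorem immaculate_ofWord {A : Type u} [Finite A] (u : List A) :
    immaculate (ofWord u) = Hw u := by
  by_cases hu : u = []
  · subst hu; rfl
  · rw [Hw, ofWord_of_ne_nil hu, immaculate_cons, immaculate_nil, bernstein_one]

/-! ### The Pieri rule -/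

open Classical in
/-- The sentences obtained from `J` by distributing the word `u` over the ends of the words of `J`
and one possible new last word: the letters of `u` are used from the bottom row to the top row. -/
def pieri {A : Type u} : Sentence A → List A → Finset (Sentence A)
  | [], u => {ofWord u}
  | v :: J, u => (Finset.range (u.length + 1)).biUnion fun k =>
      (pieri J (u.take k)).image (v.append (u.drop k) :: ·)

theorem bernstein_sum {A : Type u} [Finite A] {ι : Type*} (v : Word A) (s : Finset ι)
    (f : ι → NSym A) : bernstein v (∑ i ∈ s, f i) = ∑ i ∈ s, bernstein v (f i) := by
  have h : ∀ Q, bernsteinTerm v (∑ i ∈ s, f i) Q = ∑ i ∈ s, bernsteinTerm v (f i) Q := by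
    intro Q
    have : coarsePerp Q (∑ i ∈ s, f i) = ∑ i ∈ s, coarsePerp Q (f i) := by
      simp only [coarsePerp, ← rightPerpL_apply, map_sum]
      rw [Finset.sum_comm]
    rw [bernsteinTerm, this, Finset.mul_sum, Finset.smul_sum]
    rfl
  simp only [bernstein_eq_finsum, h]
  exact finsum_sum_comm _ _ fun i _ => bernsteinTerm_finite v (f i)

/-- The right Pieri rule for the colored immaculate functions. -/
theorem immaculate_mul_Hw {A : Type u} [Finite A] (J : Sentence A) (u : List A) :
    immaculate J * Hw u = ∑ I ∈ pieri J u, immaculate I := by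
  classical
  induction J generalizing u with
  | nil => simp [immaculate_nil, pieri, immaculate_ofWord]
  | cons v J ih =>
    rw [immaculate_cons, bernstein_mul_Hw, pieri, Finset.sum_biUnion]
    · refine Finset.sum_congr rfl fun k _ => ?_
      rw [ih, bernstein_sum, Finset.sum_image (fun _ _ _ _ h => (List.cons.inj h).2)]
      exact Finset.sum_congr rfl fun I _ => (immaculate_cons _ _).symm
    · intro k hk l hl hkl
      rw [Function.onFun, Finset.disjoint_left]
      intro I hI hI'
      rw [Finset.mem_image] at hI hI'
      obtain ⟨K, -, rfl⟩ := hI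
      obtain ⟨L, -, h⟩ := hI'
      have h1 := congrArg (fun w : Word A => w.1.length) (List.cons.inj h).1
      simp only [Word.append, List.length_append, List.length_drop] at h1
      simp only [Finset.coe_range, Set.mem_Iio] at hk hl
      omega

theorem wordAt_nil {A : Type u} (r : ℕ) : wordAt ([] : Sentence A) r = [] := by simp [wordAt]

theorem wordAt_cons_zero {A : Type u} (w : Word A) (I : Sentence A) : wordAt (w :: I) 0 = w.1 := by
  simp [wordAt]

theorem wordAt_cons_succ {A : Type u} (w : Word A) (I : Sentence A) (r : ℕ) :
    wordAt (w :: I) (r + 1) = wordAt I r := by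
  simp [wordAt]

theorem wordAt_eq_nil_iff {A : Type u} {I : Sentence A} {r : ℕ} :
    wordAt I r = [] ↔ I.length ≤ r := by
  constructor
  · intro h
    by_contra hc
    simp only [wordAt, List.getElem?_eq_getElem (not_le.1 hc)] at h
    exact (I[r]).2 h
  · intro h
    simp [wordAt, List.getElem?_eq_none h]

theorem wordAt_injective {A : Type u} {I J : Sentence A} (h : ∀ r, wordAt I r = wordAt J r) :
    I = J := by
  have hl : I.length = J.length := by
    apply le_antisymm
    · rw [← wordAt_eq_nil_iff, h, wordAt_eq_nil_iff]
    · rw [← wordAt_eq_nil_iff, ← h, wordAt_eq_nil_iff]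
  refine List.ext_getElem hl fun r h1 h2 => Subtype.ext ?_
  simpa [wordAt, h1, h2] using h r

theorem leftContained_nil {A : Type u} (I : Sentence A) : LeftContained [] I :=
  ⟨by simp, fun r => by simp [wordAt_nil]⟩

theorem LeftContained.refl {A : Type u} (I : Sentence A) : LeftContained I I :=
  ⟨le_rfl, fun _ => List.prefix_refl _⟩

theorem LeftContained.trans {A : Type u} {I J K : Sentence A} (h : LeftContained I J)
    (h' : LeftContained J K) : LeftContained I K :=
  ⟨h.1.trans h'.1, fun r => (h.2 r).trans (h'.2 r)⟩

theorem leftContained_of_prefix {A : Type u} {J I : Sentence A}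
    (h : ∀ r, wordAt J r <+: wordAt I r) : LeftContained J I := by
  refine ⟨?_, h⟩
  rw [← wordAt_eq_nil_iff]
  have := h I.length
  rwa [wordAt_eq_nil_iff.2 le_rfl, List.prefix_nil] at this

theorem leftContained_cons {A : Type u} {v w : Word A} {J I : Sentence A} :
    LeftContained (v :: J) (w :: I) ↔ v.1 <+: w.1 ∧ LeftContained J I := by
  constructor
  · intro h
    refine ⟨by simpa [wordAt_cons_zero] using h.2 0, leftContained_of_prefix fun r => ?_⟩
    simpa [wordAt_cons_succ] using h.2 (r + 1)
  · rintro ⟨h1, h2⟩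
    refine leftContained_of_prefix fun r => ?_
    cases r with
    | zero => simpa [wordAt_cons_zero] using h1
    | succ r => simpa [wordAt_cons_succ] using h2.2 r

/-- The word of the letters of `I` outside `J`, read from left to right within rows, from the
bottom row to the top row. -/
def stripWord {A : Type u} (I J : Sentence A) : List A :=
  (List.range I.length).reverse.flatMap fun r => (wordAt I r).drop (wordAt J r).length

theorem stripWord_cons {A : Type u} (v w : Word A) (I J : Sentence A) :
    stripWord (w :: I) (v :: J) = stripWord I J ++ w.1.drop v.1.length := by
  simp only [stripWord, List.length_cons, List.range_succ_eq_map, List.reverse_cons,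
    List.flatMap_append, List.flatMap_singleton, wordAt_cons_zero, ← List.map_reverse,
    List.flatMap_map, wordAt_cons_succ]

theorem mem_pieri {A : Type u} {I J : Sentence A} {u : List A} :
    I ∈ pieri J u ↔ LeftContained J I ∧ I.length ≤ J.length + 1 ∧ stripWord I J = u := by
  induction J generalizing I u with
  | nil =>
    rw [pieri, Finset.mem_singleton]
    constructor
    · rintro rfl
      refine ⟨leftContained_nil _, ?_, ?_⟩
      · by_cases hu : u = []
        · simp [hu, ofWord_nil]
        · simp [ofWord_of_ne_nil hu]
      · by_cases hu : u = []
        · simp [hu, ofWord_nil, stripWord]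
        · simp [ofWord_of_ne_nil hu, stripWord, wordAt]
    · rintro ⟨-, h1, rfl⟩
      match I, h1 with
      | [], _ => rfl
      | [w], _ =>
        have : stripWord [w] [] = w.1 := by simp [stripWord, wordAt]
        rw [this, ofWord_val]
  | cons v J ih =>
    simp only [pieri, Finset.mem_biUnion, Finset.mem_range, Finset.mem_image]
    constructor
    · rintro ⟨k, hk, I, hI, rfl⟩
      obtain ⟨h1, h2, h3⟩ := ih.1 hI
      refine ⟨leftContained_cons.2 ⟨List.prefix_append _ _, h1⟩, by simpa using h2, ?_⟩
      rw [stripWord_cons, h3]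
      simp [Word.append]
    · rintro ⟨h1, h2, rfl⟩
      cases I with
      | nil => exact absurd h1.1 (by simp)
      | cons w I =>
        obtain ⟨h3, h4⟩ := leftContained_cons.1 h1
        refine ⟨(stripWord I J).length, ?_, I, ih.2 ⟨h4, by simpa using h2, ?_⟩, ?_⟩
        · rw [stripWord_cons, List.length_append]
          omega
        · rw [stripWord_cons, List.take_left']
          rfl
        · rw [stripWord_cons, List.drop_left' rfl]
          congr 1
          obtain ⟨s, hs⟩ := h3
          apply Subtype.ext
          simp [Word.append, ← hs]

theorem size_nil {A : Type u} : size ([] : Sentence A) = 0 := rfl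

theorem size_cons {A : Type u} (w : Word A) (I : Sentence A) :
    size (w :: I) = w.1.length + size I := by
  simp [size]

theorem size_append {A : Type u} (I J : Sentence A) : size (I ++ J) = size I + size J := by
  simp [size]

theorem mem_sentences {A : Type u} [Finite A] {n : ℕ} {I : Sentence A} :
    I ∈ sentences A n ↔ size I = n := by
  simp [sentences]

theorem size_of_mem_pieri {A : Type u} {I J : Sentence A} {u : List A} (h : I ∈ pieri J u) :
    size I = size J + u.length := by
  induction J generalizing I u with
  | nil =>
    rw [pieri, Finset.mem_singleton] at h
    subst h
    by_cases hu : u = []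
    · simp [hu, ofWord_nil, size]
    · simp [ofWord_of_ne_nil hu, size]
  | cons v J ih =>
    simp only [pieri, Finset.mem_biUnion, Finset.mem_range, Finset.mem_image] at h
    obtain ⟨k, hk, I, hI, rfl⟩ := h
    have := ih hI
    rw [size_cons, size_cons, this]
    simp only [Word.append, List.length_append, List.length_drop, List.length_take]
    omega

/-! ### Reading words of tableaux -/

/-- The color of the box `p` of the diagram of `I`, if there is such a box. -/
def colorAt {A : Type u} (I : Sentence A) (p : ℕ × ℕ) : Option A := (wordAt I p.1)[p.2]?

theorem colorAt_of_leftContained {A : Type u} {L I : Sentence A} (h : LeftContained L I)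
    {p : ℕ × ℕ} (hp : p.2 < (wordAt L p.1).length) : colorAt L p = colorAt I p := by
  obtain ⟨s, hs⟩ := h.2 p.1
  rw [colorAt, colorAt, ← hs, List.getElem?_append_left hp]

theorem filterMap_range_getElem? {α : Type u} (l : List α) :
    (List.range l.length).filterMap (fun c => l[c]?) = l := by
  induction l with
  | nil => rfl
  | cons a l ih =>
    rw [List.length_cons, List.range_succ_eq_map, List.filterMap_cons]
    simp only [List.getElem?_cons_zero, List.filterMap_map]
    exact congrArg (a :: ·) ih

theorem filterMap_range'_getElem? {α : Type u} (l : List α) (s : ℕ) :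
    (List.range' s (l.length - s)).filterMap (fun c => l[c]?) = l.drop s := by
  rw [List.range'_eq_map_range, List.filterMap_map, ← List.length_drop]
  conv_rhs => rw [← filterMap_range_getElem? (l.drop s)]
  refine List.filterMap_congr fun c _ => ?_
  simp

theorem filterMap_colorAt_boxes {A : Type u} (I J : Sentence A) :
    (boxes I J).filterMap (colorAt I) = stripWord I J := by
  rw [boxes, stripWord, List.filterMap_flatMap]
  congr 1
  funext r
  rw [List.filterMap_map, ← filterMap_range'_getElem?]
  rfl

/-- The reading order on boxes: from the bottom row to the top row, and from left to right within
a row. -/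
def ReadingLT (p q : ℕ × ℕ) : Prop := q.1 < p.1 ∨ (p.1 = q.1 ∧ p.2 < q.2)

theorem boxes_pairwise {A : Type u} (I J : Sentence A) : (boxes I J).Pairwise ReadingLT := by
  rw [boxes, List.pairwise_flatMap]
  constructor
  · intro r _
    rw [List.pairwise_map]
    exact (List.pairwise_lt_range' (step := 1)).imp fun h => Or.inr ⟨rfl, h⟩
  · rw [List.pairwise_reverse]
    refine List.pairwise_lt_range.imp fun {r s} h p hp q hq => ?_
    obtain ⟨c, -, rfl⟩ := List.mem_map.1 hp
    obtain ⟨d, -, rfl⟩ := List.mem_map.1 hq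
    exact Or.inl h

theorem filter_boxes_eq {A : Type u} {I J I' J' : Sentence A} (P : ℕ × ℕ → Bool)
    (h : ∀ p, p ∈ boxes I J ∧ P p ↔ p ∈ boxes I' J') :
    (boxes I J).filter P = boxes I' J' := by
  have hnd : ∀ l : List (ℕ × ℕ), l.Pairwise ReadingLT → l.Nodup := by
    intro l hl
    refine hl.imp fun {p q} h => ?_
    rintro rfl
    rcases h with h | h
    · exact lt_irrefl _ h
    · exact lt_irrefl _ h.2
  have h1 := (boxes_pairwise I J).filter P
  have h2 := boxes_pairwise I' J'
  refine List.Perm.eq_of_pairwise ?_ h1 h2 ?_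
  · rintro p q - - h3 h4
    simp only [ReadingLT] at h3 h4
    omega
  · rw [List.perm_ext_iff_of_nodup (hnd _ h1) (hnd _ h2)]
    intro p
    rw [List.mem_filter, h]

open Classical in
theorem Tableau.word_eq_filterMap {A : Type u} {I J : Sentence A} (T : Tableau I J) (i : ℕ+) :
    T.word i = ((boxes I J).filter fun p => ∃ h : p ∈ boxes I J, T.entry ⟨p, h⟩ = i).filterMap
      (colorAt I) := by
  have h1 : ∀ p : Box I J, colorAt I p.1 = some p.color := fun p =>
    List.getElem?_eq_getElem (mem_boxes.1 p.2).2
  have h3 : ∀ P : ℕ × ℕ → Bool, (boxes I J).filter P =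
      ((boxes I J).attach.filter (P ∘ Subtype.val)).map Subtype.val := fun P => by
    rw [← List.filter_map, List.attach_map_subtype_val]
  rw [h3, List.filterMap_map, Tableau.word, ← List.filterMap_eq_map]
  have h2 : ∀ p : Box I J, (some ∘ Box.color) p = (colorAt I ∘ Subtype.val) p :=
    fun p => (h1 p).symm
  rw [funext h2]
  congr 1
  refine List.filter_congr fun p _ => ?_
  simp [p.2]

/-! ### Removing the largest entry of a tableau -/

theorem Tableau.monomial_apply {A : Type u} {I J : Sentence A} (T : Tableau I J) (i : ℕ+) :
    T.monomial i = FreeAddMonoid.ofList (T.word i) := rfl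

/-- If a tableau of shape `I/J` arises from one of shape `L/J` by filling the boxes of `I/L` with an
entry larger than all others, then its monomial arises by multiplication with the word of `I/L`. -/
theorem Tableau.monomial_eq_add_single {A : Type u} {I J L : Sentence A} (hJL : LeftContained J L)
    (hLI : LeftContained L I) (T : Tableau I J) (T' : Tableau L J) (b : ℕ+)
    (h1 : ∀ p (h : p ∈ boxes I J) (h' : p ∈ boxes L J), T.entry ⟨p, h⟩ = T'.entry ⟨p, h'⟩)
    (h2 : ∀ p (h : p ∈ boxes I J), p ∉ boxes L J → T.entry ⟨p, h⟩ = b)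
    (h3 : ∀ p, T'.entry p < b) :
    T.monomial = T'.monomial + Finsupp.single b (FreeAddMonoid.ofList (stripWord I L)) := by
  classical
  have hsub : ∀ p, p ∈ boxes L J → p ∈ boxes I J := by
    intro p hp
    rw [mem_boxes] at hp ⊢
    exact ⟨hp.1, hp.2.trans_le (hLI.2 p.1).length_le⟩
  ext i
  rw [Finsupp.add_apply, Tableau.monomial_apply, Tableau.monomial_apply]
  by_cases hi : i = b
  · subst hi
    have h4 : T'.word i = [] := by
      simp only [Tableau.word, List.map_eq_nil_iff, List.filter_eq_nil_iff, decide_eq_true_eq]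
      exact fun p _ => (h3 p).ne
    rw [h4, Finsupp.single_eq_same, FreeAddMonoid.ofList_nil, zero_add, T.word_eq_filterMap,
      ← filterMap_colorAt_boxes]
    congr 2
    refine filter_boxes_eq _ fun p => ?_
    have h5 := (hJL.2 p.1).length_le
    simp only [decide_eq_true_eq]
    constructor
    · rintro ⟨h, h', h6⟩
      have h7 : p ∉ boxes L J := fun h8 => (h3 ⟨p, h8⟩).ne (by rw [← h1 p h' h8, h6])
      rw [mem_boxes] at h h7 ⊢
      omega
    · intro h
      have h8 : p ∈ boxes I J := by
        rw [mem_boxes] at h ⊢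
        omega
      refine ⟨h8, h8, h2 p h8 fun h9 => ?_⟩
      rw [mem_boxes] at h h9
      omega
  · rw [Finsupp.single_eq_of_ne hi, add_zero, T.word_eq_filterMap, T'.word_eq_filterMap]
    have h4 : (boxes I J).filter (fun p => decide (p ∈ boxes L J)) = boxes L J :=
      filter_boxes_eq _ fun p => by
        simp only [decide_eq_true_eq]
        exact ⟨fun h => h.2, fun h => ⟨hsub p h, h⟩⟩
    have h5 : (boxes I J).filter (fun p => decide (∃ h, T.entry ⟨p, h⟩ = i)) =
        ((boxes I J).filter (fun p => decide (p ∈ boxes L J))).filter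
          fun p => decide (∃ h, T'.entry ⟨p, h⟩ = i) := by
      rw [List.filter_filter]
      refine List.filter_congr fun p hp => ?_
      rw [← Bool.decide_and, decide_eq_decide]
      constructor
      · rintro ⟨h, rfl⟩
        by_cases h6 : p ∈ boxes L J
        · exact ⟨⟨h6, (h1 p h h6).symm⟩, h6⟩
        · exact absurd (h2 p h h6) hi
      · rintro ⟨⟨h, rfl⟩, -⟩
        exact ⟨hp, h1 p hp h⟩
    rw [h5, h4]
    congr 1
    refine List.filterMap_congr fun p hp => ?_
    exact (colorAt_of_leftContained hLI (mem_boxes.1 (List.mem_filter.1 hp).1).2).symm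

/-- The tableau of shape `I/J` obtained from one of shape `L/J` by filling the remaining boxes, at
most one of which lies in the first column, with a larger entry `b`. -/
def Tableau.extend {A : Type u} {I J L : Sentence A}
    (hlen : I.length ≤ L.length + 1) (T : Tableau L J) (b : ℕ+) (hT : ∀ p, T.entry p < b) :
    Tableau I J where
  entry p := open Classical in if h : p.1 ∈ boxes L J then T.entry ⟨p.1, h⟩ else b
  row_weak := by
    rintro ⟨p, hp⟩ ⟨q, hq⟩ h1 h2
    simp only at h1 h2 ⊢
    by_cases h : q ∈ boxes L J
    · have h' : p ∈ boxes L J := by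
        rw [mem_boxes] at h hp hq ⊢
        rw [h1] at hp ⊢
        omega
      rw [dif_pos h, dif_pos h']
      exact T.row_weak _ _ h1 h2
    · rw [dif_neg h]
      split_ifs with h'
      · exact (hT _).le
      · exact le_rfl
  col_strict := by
    rintro ⟨p, hp⟩ ⟨q, hq⟩ h1 h2 h3
    simp only at h1 h2 h3 ⊢
    have hqI : q.1 < I.length := by
      by_contra hc
      rw [mem_boxes, wordAt_eq_nil_iff.2 (not_lt.1 hc)] at hq
      simp at hq
    have h' : p ∈ boxes L J := by
      rw [mem_boxes] at hp ⊢
      refine ⟨hp.1, ?_⟩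
      rw [h1, List.length_pos_iff, Ne, wordAt_eq_nil_iff]
      omega
    rw [dif_pos h']
    split_ifs with h
    · exact T.col_strict _ _ h1 h2 h3
    · exact hT _

/-- A sequence of words in which empty words are only followed by empty words, and which is
eventually empty, is the sequence of rows of a sentence. -/
theorem exists_wordAt_eq {A : Type u} (n : ℕ) (l : ℕ → List A) (h1 : ∀ r, n ≤ r → l r = [])
    (h2 : ∀ r, l r = [] → l (r + 1) = []) : ∃ L : Sentence A, ∀ r, wordAt L r = l r := by
  induction n generalizing l with
  | zero => exact ⟨[], fun r => by rw [wordAt_nil, h1 r (Nat.zero_le r)]⟩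
  | succ n ih =>
    by_cases h0 : l 0 = []
    · refine ⟨[], fun r => ?_⟩
      rw [wordAt_nil]
      induction r with
      | zero => exact h0.symm
      | succ r ihr => exact (h2 r ihr.symm).symm
    · obtain ⟨L, hL⟩ := ih (fun r => l (r + 1)) (fun r hr => h1 _ (by omega)) fun r => h2 (r + 1)
      refine ⟨⟨l 0, h0⟩ :: L, fun r => ?_⟩
      cases r with
      | zero => rw [wordAt_cons_zero]
      | succ r => rw [wordAt_cons_succ, hL]

/-- The boxes of a tableau with entries at most `b` that do not contain the entry `b` form a skew
shape `L/J`, and `L` has at most one word less than `I`. -/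
theorem Tableau.exists_shape_lt {A : Type u} {I J : Sentence A} (hJI : LeftContained J I)
    (T : Tableau I J) (b : ℕ+) (hT : ∀ p, T.entry p ≤ b) :
    ∃ L, LeftContained J L ∧ LeftContained L I ∧ I.length ≤ L.length + 1 ∧
      ∀ p (h : p ∈ boxes I J), T.entry ⟨p, h⟩ < b ↔ p ∈ boxes L J := by
  classical
  -- in row `r`, the word of `L` ends before the first box of `I/J` with an entry at least `b`
  have hex : ∀ r, ∃ c, (wordAt J r).length ≤ c ∧
      ∀ h : (r, c) ∈ boxes I J, b ≤ T.entry ⟨(r, c), h⟩ := by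
    intro r
    refine ⟨(wordAt I r).length, (hJI.2 r).length_le, fun h => ?_⟩
    rw [mem_boxes] at h
    exact absurd h.2 (lt_irrefl _)
  let c : ℕ → ℕ := fun r => Nat.find (hex r)
  have hJc : ∀ r, (wordAt J r).length ≤ c r := fun r => (Nat.find_spec (hex r)).1
  have hcb : ∀ r (h : (r, c r) ∈ boxes I J), b ≤ T.entry ⟨(r, c r), h⟩ :=
    fun r => (Nat.find_spec (hex r)).2
  have hcI : ∀ r, c r ≤ (wordAt I r).length := by
    intro r
    refine Nat.find_min' (hex r) ⟨(hJI.2 r).length_le, fun h => ?_⟩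
    rw [mem_boxes] at h
    exact absurd h.2 (lt_irrefl _)
  have hlt : ∀ p (h : p ∈ boxes I J), T.entry ⟨p, h⟩ < b ↔ p.2 < c p.1 := by
    intro p h
    constructor
    · intro h1
      by_contra hc
      have h2 : (p.1, c p.1) ∈ boxes I J := by
        rw [mem_boxes] at h ⊢
        exact ⟨hJc _, by simp only; omega⟩
      exact absurd ((hcb p.1 h2).trans (T.row_weak ⟨_, h2⟩ ⟨p, h⟩ rfl (not_lt.1 hc))) h1.not_ge
    · intro h1
      have h2 := Nat.find_min (hex p.1) h1
      by_contra hc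
      exact h2 ⟨(mem_boxes.1 h).1, fun _ => not_lt.1 hc⟩
  -- the first column strictly increases, so at most one of its boxes, the last one, contains `b`
  have htop : ∀ r (h : (r, 0) ∈ boxes I J) (h' : (r + 1, 0) ∈ boxes I J),
      T.entry ⟨(r, 0), h⟩ < b := fun r h h' =>
    (T.col_strict ⟨_, h⟩ ⟨_, h'⟩ rfl rfl (Nat.lt_succ_self r)).trans_le (hT _)
  obtain ⟨L, hL⟩ := exists_wordAt_eq I.length (fun r => (wordAt I r).take (c r))
    (fun r hr => by simp [wordAt_eq_nil_iff.2 hr]) (by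
      intro r hr
      by_contra hne
      have h1 : r + 1 < I.length := by
        by_contra hc
        exact hne (by simp [wordAt_eq_nil_iff.2 (not_lt.1 hc)])
      have h2 : ∀ s, s < I.length → 0 < (wordAt I s).length := fun s hs => by
        rw [List.length_pos_iff, Ne, wordAt_eq_nil_iff]
        omega
      have h3 : c r = 0 := by
        have := congrArg List.length hr
        have := h2 r (by omega)
        simp only [List.length_take, List.length_nil] at *
        omega
      have h4 : wordAt J r = [] := List.length_eq_zero_iff.1 (by have := hJc r; omega)
      have h5 : wordAt J (r + 1) = [] := by
        rw [wordAt_eq_nil_iff] at h4 ⊢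
        omega
      have h6 : (r, 0) ∈ boxes I J := mem_boxes.2 ⟨by simp [h4], h2 r (by omega)⟩
      have h7 : (r + 1, 0) ∈ boxes I J := mem_boxes.2 ⟨by simp [h5], h2 _ h1⟩
      have h8 := (hlt _ h6).1 (htop r h6 h7)
      simp only [h3, lt_irrefl] at h8)
  have hLlen : ∀ r, (wordAt L r).length = c r := fun r => by
    rw [hL, List.length_take, min_eq_left (hcI r)]
  have hLI : LeftContained L I := leftContained_of_prefix fun r => by
    rw [hL]
    exact List.take_prefix _ _
  have hJL : LeftContained J L := leftContained_of_prefix fun r =>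
    List.prefix_of_prefix_length_le (hJI.2 r) (hLI.2 r) (by rw [hLlen]; exact hJc r)
  have hbox : ∀ p (h : p ∈ boxes I J), T.entry ⟨p, h⟩ < b ↔ p ∈ boxes L J := by
    intro p h
    rw [hlt p h, mem_boxes, hLlen]
    exact ⟨fun h' => ⟨(mem_boxes.1 h).1, h'⟩, fun h' => h'.2⟩
  refine ⟨L, hJL, hLI, ?_, hbox⟩
  by_contra hc
  have h1 : ∀ s, L.length ≤ s → s < I.length → (s, 0) ∈ boxes I J := by
    intro s hs hs'
    have h2 : wordAt J s = [] := wordAt_eq_nil_iff.2 (hJL.1.trans hs)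
    refine mem_boxes.2 ⟨by simp [h2], ?_⟩
    rw [List.length_pos_iff, Ne, wordAt_eq_nil_iff]
    omega
  have h2 := h1 L.length le_rfl (by omega)
  have h3 := (mem_boxes.1 ((hbox _ h2).1 (htop _ h2 (h1 _ (by omega) (by omega))))).2
  rw [wordAt_eq_nil_iff.2 le_rfl] at h3
  exact absurd h3 (by simp)

theorem mem_subSentences {A : Type u} {I J : Sentence A} :
    J ∈ subSentences I ↔ LeftContained J I := by
  simp [subSentences]

open Classical in
/-- The number of skew colored immaculate tableaux of shape `I/J` and type `K`, set to be zero if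
`J` is not left contained in `I`. -/
def tabCount {A : Type u} (I J K : Sentence A) : ℚ :=
  if LeftContained J I then tableauSeries I J (canon K) else 0

theorem tabCount_of_leftContained {A : Type u} {I J : Sentence A} (h : LeftContained J I)
    (K : Sentence A) : tabCount I J K = tableauSeries I J (canon K) := if_pos h

theorem Tableau.entry_lt_of_monomial_eq {A : Type u} {I J K : Sentence A} {T : Tableau I J}
    (h : T.monomial = canon K) (p : Box I J) : T.entry p < K.length.succPNat :=
  lt_of_mem_support_canon K _ (h ▸ T.entry_mem_support p)

theorem eq_of_boxes_eq_nil {A : Type u} {I J : Sentence A} (h : LeftContained J I)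
    (hb : ∀ p, p ∉ boxes I J) : I = J := by
  refine wordAt_injective fun r => ((h.2 r).eq_of_length ?_).symm
  refine le_antisymm (h.2 r).length_le ?_
  by_contra hc
  exact hb (r, (wordAt J r).length) (mem_boxes.2 ⟨le_rfl, not_le.1 hc⟩)

theorem tabCount_nil {A : Type u} [DecidableEq A] (I J : Sentence A) :
    tabCount I J [] = if I = J then 1 else 0 := by
  split_ifs with hIJ
  · subst hIJ
    rw [tabCount_of_leftContained (LeftContained.refl I), tableauSeries]
    have hb : ∀ p, p ∉ boxes I I := fun p hp => by
      rw [mem_boxes] at hp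
      omega
    have : Unique {T : Tableau I I // T.monomial = canon []} :=
      { default := ⟨⟨fun _ => 1, fun p => absurd p.2 (hb _), fun p => absurd p.2 (hb _)⟩, by
          ext i
          rw [Tableau.monomial_apply, canon_nil, Tableau.word]
          have : (boxes I I).attach = [] := List.attach_eq_nil_iff.2
            (List.eq_nil_iff_forall_not_mem.2 hb)
          rw [this]
          rfl⟩
        uniq := fun T => Subtype.ext (Tableau.ext (funext fun p => absurd p.2 (hb _))) }
    simp
  · rw [tabCount]
    split_ifs with h
    · rw [tableauSeries, Nat.cast_eq_zero, Nat.card_eq_zero]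
      left
      constructor
      rintro ⟨T, hT⟩
      refine hIJ (eq_of_boxes_eq_nil h fun p hp => ?_)
      have := T.entry_mem_support ⟨p, hp⟩
      rw [hT, canon_nil] at this
      simp at this
    · rfl

/-- Removing the largest entry: a skew tableau of shape `I/J` and type `K · u` consists of a
tableau of type `K` on a smaller shape `L/J` and a strip `I/L` with word `u`. -/
theorem tabCount_concat {A : Type u} [DecidableEq A] (I J K : Sentence A) (u : Word A) :
    tabCount I J (K ++ [u]) =
      ∑ L ∈ subSentences I, if I ∈ pieri L u.1 then tabCount L J K else 0 := by
  classical
  by_cases hJI : LeftContained J I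
  swap
  · rw [tabCount, if_neg hJI]
    refine (Finset.sum_eq_zero fun L hL => ?_).symm
    have : ¬ LeftContained J L := fun h => hJI (h.trans (mem_subSentences.1 hL))
    simp [tabCount, this]
  rw [tabCount_of_leftContained hJI]
  let S : Finset (Sentence A) := {L ∈ subSentences I | I ∈ pieri L u.1 ∧ LeftContained J L}
  have hS : ∀ L, L ∈ S ↔ I ∈ pieri L u.1 ∧ LeftContained J L := by
    intro L
    simp only [S, Finset.mem_filter, mem_subSentences, and_iff_right_iff_imp]
    exact fun h => (mem_pieri.1 h.1).1
  have h1 : (∑ L ∈ subSentences I, if I ∈ pieri L u.1 then tabCount L J K else 0) =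
      ∑ L ∈ S, tableauSeries L J (canon K) := by
    rw [Finset.sum_filter]
    refine Finset.sum_congr rfl fun L _ => ?_
    by_cases h : I ∈ pieri L u.1 <;> simp [h, tabCount]
  rw [h1]
  set b := K.length.succPNat with hb
  have hfin := fun L : Sentence A => Tableau.finite_monomial L J (canon K)
  -- glue a tableau of shape `L/J` and the strip `I/L`, filled with the new largest entry
  let f : (Σ L : S, {T : Tableau L.1 J // T.monomial = canon K}) →
      {T : Tableau I J // T.monomial = canon (K ++ [u])} := fun x =>
    ⟨x.2.1.extend (mem_pieri.1 ((hS _).1 x.1.2).1).2.1 b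
      (Tableau.entry_lt_of_monomial_eq x.2.2), by
        obtain ⟨⟨L, hL⟩, T, hT⟩ := x
        obtain ⟨h2, h3⟩ := (hS _).1 hL
        obtain ⟨h4, h5, h6⟩ := mem_pieri.1 h2
        rw [Tableau.monomial_eq_add_single h3 h4 _ T b, h6, hT, canon_concat]
        · intro p h h'
          exact dif_pos h'
        · intro p h h'
          exact dif_neg h'
        · exact Tableau.entry_lt_of_monomial_eq hT⟩
  have hf : Function.Bijective f := by
    constructor
    · rintro ⟨⟨L, hL⟩, T, hT⟩ ⟨⟨L', hL'⟩, T', hT'⟩ h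
      have h2 : ∀ p (hp : p ∈ boxes I J),
          (if h : p ∈ boxes L J then T.entry ⟨p, h⟩ else b) =
            if h : p ∈ boxes L' J then T'.entry ⟨p, h⟩ else b := by
        intro p hp
        exact congrArg (fun T : {T : Tableau I J // T.monomial = canon (K ++ [u])} =>
          T.1.entry ⟨p, hp⟩) h
      have hLI := (mem_pieri.1 ((hS _).1 hL).1).1
      have hLI' := (mem_pieri.1 ((hS _).1 hL').1).1
      have hJL := ((hS _).1 hL).2
      have hJL' := ((hS _).1 hL').2
      have h3 : ∀ p, p ∈ boxes L J ↔ p ∈ boxes L' J := by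
        intro p
        constructor
        · intro hp
          by_contra hc
          have h4 := h2 p (mem_boxes.2 ⟨(mem_boxes.1 hp).1,
            (mem_boxes.1 hp).2.trans_le (hLI.2 p.1).length_le⟩)
          rw [dif_pos hp, dif_neg hc] at h4
          exact (Tableau.entry_lt_of_monomial_eq hT ⟨p, hp⟩).ne h4
        · intro hp
          by_contra hc
          have h4 := h2 p (mem_boxes.2 ⟨(mem_boxes.1 hp).1,
            (mem_boxes.1 hp).2.trans_le (hLI'.2 p.1).length_le⟩)
          rw [dif_pos hp, dif_neg hc] at h4
          exact (Tableau.entry_lt_of_monomial_eq hT' ⟨p, hp⟩).ne h4.symm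
      have hLL : L = L' := by
        refine wordAt_injective fun r => ?_
        have h4 := h3 (r, (wordAt L r).length)
        have h5 := h3 (r, (wordAt L' r).length)
        have h6 := (hJL.2 r).length_le
        have h7 := (hJL'.2 r).length_le
        simp only [mem_boxes] at h4 h5
        have h8 : (wordAt L r).length = (wordAt L' r).length := by omega
        exact (List.prefix_of_prefix_length_le (hLI.2 r) (hLI'.2 r) h8.le).eq_of_length h8
      subst hLL
      have hTT : T = T' := by
        ext p : 2
        have h4 := h2 p.1 (mem_boxes.2 ⟨(mem_boxes.1 p.2).1,
            (mem_boxes.1 p.2).2.trans_le (hLI.2 p.1.1).length_le⟩)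
        rwa [dif_pos p.2, dif_pos p.2] at h4
      subst hTT
      rfl
    · rintro ⟨T, hT⟩
      have hle : ∀ p, T.entry p ≤ b := by
        intro p
        have := Tableau.entry_lt_of_monomial_eq hT p
        rw [List.length_append, List.length_singleton] at this
        exact PNat.lt_add_one_iff.1 this
      obtain ⟨L, hJL, hLI, hlen, hbox⟩ := T.exists_shape_lt hJI b hle
      have hsub : ∀ p, p ∈ boxes L J → p ∈ boxes I J := fun p hp =>
        mem_boxes.2 ⟨(mem_boxes.1 hp).1, (mem_boxes.1 hp).2.trans_le (hLI.2 p.1).length_le⟩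
      let T' : Tableau L J :=
        { entry := fun p => T.entry ⟨p.1, hsub _ p.2⟩
          row_weak := fun p q h1 h2 => T.row_weak _ _ h1 h2
          col_strict := fun p q h1 h2 h3 => T.col_strict _ _ h1 h2 h3 }
      have hT'b : ∀ p, T'.entry p < b := fun p => (hbox p.1 (hsub _ p.2)).2 p.2
      have hTb : ∀ p (h : p ∈ boxes I J), p ∉ boxes L J → T.entry ⟨p, h⟩ = b := fun p h h' =>
        le_antisymm (hle _) (not_lt.1 fun h'' => h' ((hbox p h).1 h''))
      have hmon := Tableau.monomial_eq_add_single hJL hLI T T' b (fun _ _ _ => rfl) hTb hT'b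
      rw [hT, canon_concat] at hmon
      have h0 : canon K b = 0 := by
        by_contra h
        exact lt_irrefl _ (lt_of_mem_support_canon K _ (Finsupp.mem_support_iff.2 h))
      have h0' : T'.monomial b = 0 := by
        rw [Tableau.monomial_apply]
        have : T'.word b = [] := by
          simp only [Tableau.word, List.map_eq_nil_iff, List.filter_eq_nil_iff, decide_eq_true_eq]
          exact fun p _ => (hT'b p).ne
        rw [this]
        rfl
      have hu : stripWord I L = u.1 := by
        have := DFunLike.congr_fun hmon b
        rw [Finsupp.add_apply, Finsupp.add_apply, h0, h0', Finsupp.single_eq_same,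
          Finsupp.single_eq_same, zero_add, zero_add] at this
        exact this.symm
      have hK : T'.monomial = canon K := by
        ext i
        by_cases hi : i = b
        · rw [hi, h0, h0']
        · have := DFunLike.congr_fun hmon i
          rw [Finsupp.add_apply, Finsupp.add_apply, Finsupp.single_eq_of_ne hi,
            Finsupp.single_eq_of_ne hi, add_zero, add_zero] at this
          exact this.symm
      refine ⟨⟨⟨L, (hS L).2 ⟨mem_pieri.2 ⟨hLI, hlen, hu⟩, hJL⟩⟩, T', hK⟩, ?_⟩
      apply Subtype.ext
      ext p : 2
      change (if h : p.1 ∈ boxes L J then T'.entry ⟨p.1, h⟩ else b) = T.entry p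
      split_ifs with h
      · rfl
      · exact (hTb p.1 p.2 h).symm
  have hcard := Nat.card_eq_of_bijective f hf
  have : ∀ L : S, Finite {T : Tableau L.1 J // T.monomial = canon K} := fun L => hfin L.1
  rw [Nat.card_sigma] at hcard
  rw [tableauSeries, ← hcard, Nat.cast_sum]
  exact Finset.sum_coe_sort S fun L => tableauSeries L J (canon K)

theorem size_eq_of_tabCount_ne_zero {A : Type u} {I J K : Sentence A} (h : tabCount I J K ≠ 0) :
    size I = size J + size K := by
  classical
  induction K using List.reverseRecOn generalizing I with
  | nil =>
    rw [tabCount_nil] at h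
    have : I = J := by
      by_contra hc
      exact h (if_neg hc)
    rw [this, size_nil, add_zero]
  | append_singleton K u ih =>
    rw [tabCount_concat] at h
    obtain ⟨L, -, h1⟩ := Finset.exists_ne_zero_of_sum_ne_zero h
    have h2 : I ∈ pieri L u.1 := by
      by_contra hc
      exact h1 (if_neg hc)
    rw [if_pos h2] at h1
    rw [size_of_mem_pieri h2, ih h1, size_append, size_cons, size_nil]
    omega

/-! ### The basis of immaculate functions -/

/-- Iterating the Pieri rule, the coefficients of `𝔖_J H_K` in terms of immaculate functions count
skew tableaux of type `K`. -/
theorem immaculate_mul_H {A : Type u} [Finite A] (J K : Sentence A) :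
    immaculate J * H K =
      ∑ I ∈ sentences A (size J + size K), tabCount I J K • immaculate I := by
  classical
  induction K using List.reverseRecOn with
  | nil =>
    rw [H_nil, mul_one, Finset.sum_eq_single J]
    · rw [tabCount_nil, if_pos rfl, one_smul]
    · intro I _ hI
      rw [tabCount_nil, if_neg hI, zero_smul]
    · intro h
      exact absurd (mem_sentences.2 (by rw [size_nil, add_zero])) h
  | append_singleton K u ih =>
    rw [H_concat, ← mul_assoc, ih, Finset.sum_mul]
    have h1 : ∀ L ∈ sentences A (size J + size K),
        (tabCount L J K • immaculate L) * Hw u.1 =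
          ∑ I ∈ sentences A (size J + size (K ++ [u])),
            (if I ∈ pieri L u.1 then tabCount L J K else 0) • immaculate I := by
      intro L hL
      rw [smul_mul_assoc, immaculate_mul_Hw, Finset.smul_sum]
      simp only [ite_smul, zero_smul]
      rw [← Finset.sum_filter]
      refine Finset.sum_congr ?_ fun _ _ => rfl
      ext I
      rw [Finset.mem_filter, mem_sentences]
      refine ⟨fun h => ⟨?_, h⟩, fun h => h.2⟩
      rw [size_of_mem_pieri h, mem_sentences.1 hL, size_append, size_cons, size_nil]
      omega
    rw [Finset.sum_congr rfl h1, Finset.sum_comm]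
    refine Finset.sum_congr rfl fun I hI => ?_
    rw [← Finset.sum_smul, tabCount_concat, ← Finset.sum_filter, ← Finset.sum_filter]
    congr 1
    refine Finset.sum_congr ?_ fun _ _ => rfl
    ext L
    rw [Finset.mem_filter, Finset.mem_filter, mem_sentences, mem_subSentences]
    refine ⟨fun h => ⟨(mem_pieri.1 h.2).1, h.2⟩, fun h => ⟨?_, h.2⟩⟩
    have h2 := size_of_mem_pieri h.2
    rw [mem_sentences.1 hI, size_append, size_cons, size_nil] at h2
    omega

theorem H_eq_sum_immaculate {A : Type u} [Finite A] (K : Sentence A) :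
    H K = ∑ I ∈ sentences A (size K), tabCount I [] K • immaculate I := by
  have := immaculate_mul_H [] K
  rwa [immaculate_nil, one_mul, size_nil, zero_add] at this

theorem span_immaculate {A : Type u} [Finite A] :
    ⊤ ≤ Submodule.span ℚ (Set.range (immaculate : Sentence A → NSym A)) := by
  rw [← (basisH A).span_eq, Submodule.span_le]
  rintro _ ⟨K, rfl⟩
  rw [basisH_apply, H_eq_sum_immaculate]
  exact Submodule.sum_mem _ fun I _ => Submodule.smul_mem _ _ (Submodule.subset_span ⟨I, rfl⟩)

/-- The immaculate functions of size at most `n` span the same finite-dimensional space as the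
equally many linearly independent functions `H_K`. -/
theorem linearIndependent_immaculate {A : Type u} [Finite A] :
    LinearIndependent ℚ (immaculate : Sentence A → NSym A) := by
  rw [linearIndependent_iff_finset_linearIndependent]
  intro s
  let B : Finset (Sentence A) := (finite_size_le (A := A) (s.sup size)).toFinset
  have hB : ∀ I, I ∈ B ↔ size I ≤ s.sup size := fun I => by simp [B]
  have hsB : s ⊆ B := fun I hI => (hB I).2 (Finset.le_sup hI)
  have hH : LinearIndependent ℚ (fun I : B => H I.1) := by
    have := (basisH A).linearIndependent.comp (fun I : B => I.1) Subtype.val_injective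
    convert this using 2 with I
    exact (basisH_apply _).symm
  have hle : Submodule.span ℚ (Set.range fun I : B => H I.1) ≤
      Submodule.span ℚ (Set.range fun I : B => immaculate I.1) := by
    rw [Submodule.span_le]
    rintro _ ⟨K, rfl⟩
    simp only
    rw [H_eq_sum_immaculate]
    refine Submodule.sum_mem _ fun I hI => Submodule.smul_mem _ _ (Submodule.subset_span ?_)
    exact ⟨⟨I, (hB I).2 ((mem_sentences.1 hI).le.trans ((hB _).1 K.2))⟩, rfl⟩
  have hS : LinearIndependent ℚ (fun I : B => immaculate I.1) := by
    rw [linearIndependent_iff_card_eq_finrank_span] at hH ⊢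
    have : Module.Finite ℚ (Submodule.span ℚ (Set.range fun I : B => immaculate I.1)) :=
      Module.Finite.span_of_finite ℚ (Set.finite_range _)
    refine le_antisymm ?_ (finrank_range_le_card _)
    rw [hH]
    exact Submodule.finrank_mono hle
  exact hS.comp (fun I : s => (⟨I.1, hsB I.2⟩ : B)) fun I J h =>
    Subtype.ext (congrArg (fun K : B => K.1) h)

/-- The basis of colored immaculate functions. -/
def immaculateBasis (A : Type u) [Finite A] : Module.Basis (Sentence A) ℚ (NSym A) :=
  Module.Basis.mk linearIndependent_immaculate span_immaculate

theorem immaculateBasis_apply {A : Type u} [Finite A] (I : Sentence A) :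
    immaculateBasis A I = immaculate I := Module.Basis.mk_apply _ _ _

theorem dualImmaculate_canon {A : Type u} (I K : Sentence A) :
    (dualImmaculate I).1 (canon K) = tabCount I [] K :=
  (tabCount_of_leftContained (leftContained_nil I) K).symm

theorem immaculateBasis_repr_sum {A : Type u} [Finite A] (J K I : Sentence A) :
    (immaculateBasis A).repr (∑ L ∈ sentences A (size J + size K),
      tabCount L J K • immaculate L) I = tabCount I J K := by
  classical
  simp only [← immaculateBasis_apply, map_sum, map_smul, Module.Basis.repr_self,
    Finsupp.finsetSum_apply, Finsupp.smul_apply, Finsupp.single_apply, smul_eq_mul, mul_ite,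
    mul_one, mul_zero]
  rw [Finset.sum_ite_eq']
  split_ifs with h
  · rfl
  · by_contra hc
    exact h (mem_sentences.2 (size_eq_of_tabCount_ne_zero (Ne.symm hc)))

/-- The dual immaculate functions are dual to the immaculate functions: the coordinate of `f` at
`𝔖_I` is `⟨f, 𝔖*_I⟩`. -/
theorem immaculateBasis_repr {A : Type u} [Finite A] (f : NSym A) (I : Sentence A) :
    (immaculateBasis A).repr f I = pairing f (dualImmaculate I).1 := by
  change ((Finsupp.lapply I).comp (immaculateBasis A).repr.toLinearMap) f =
    pairingL (dualImmaculate I).1 f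
  congr 1
  refine linearMap_ext_H fun K => ?_
  rw [pairingL_apply, pairing_H, dualImmaculate_canon, ← immaculateBasis_repr_sum [] K I,
    size_nil, zero_add, ← H_eq_sum_immaculate]
  rfl

theorem pairing_immaculate_mul_H {A : Type u} [Finite A] (I J K : Sentence A) :
    pairing (immaculate J * H K) (dualImmaculate I).1 = tabCount I J K := by
  rw [← immaculateBasis_repr, immaculate_mul_H, immaculateBasis_repr_sum]

/-! ### Ribbon functions -/

/-- The linear map `H_I ↦ H_{I'}`, where `I'` arises from `I` by gluing `t` to the last word; the
image of `H_∅` is zero. -/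
def glueL {A : Type u} (t : List A) : NSym A →ₗ[ℚ] NSym A :=
  (basisH A).constr ℚ fun S => open Classical in if S = [] then 0 else H (glueLast S t)

theorem glueL_H {A : Type u} [DecidableEq A] (t : List A) (S : Sentence A) :
    glueL t (H S) = if S = [] then 0 else H (glueLast S t) := by
  rw [glueL, ← basisH_apply, Module.Basis.constr_basis]

theorem glueL_mul_H {A : Type u} (f : NSym A) (s : Word A) (t : List A) :
    glueL t (f * H [s]) = f * H [s.append t] := by
  classical
  change (glueL t ∘ₗ LinearMap.mulRight ℚ (H [s])) f = LinearMap.mulRight ℚ (H [s.append t]) f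
  congr 1
  refine linearMap_ext_H fun K => ?_
  simp [H_mul_H, glueL_H, glueLast_concat]

theorem glueL_glueL {A : Type u} (f : NSym A) (s t : List A) :
    glueL t (glueL s f) = glueL (s ++ t) f := by
  classical
  change (glueL t ∘ₗ glueL s) f = glueL (s ++ t) f
  congr 1
  refine linearMap_ext_H fun K => ?_
  rcases List.eq_nil_or_concat' K with rfl | ⟨K, w, rfl⟩
  · simp [glueL_H]
  · simp [glueL_H, glueLast_concat, Word.append_append]

theorem R_nil {A : Type u} [Finite A] : (R [] : NSym A) = 1 := by
  simp [R, coarsenings_nil, H_nil]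

/-- The product rule for ribbon functions: `R_Q R_t` is the sum of `R_{Q · t}` and of the ribbon
function of the sentence with `t` glued to the last word of `Q`. -/
theorem R_concat {A : Type u} [Finite A] (Q : Sentence A) (t : Word A) :
    R (Q ++ [t]) = R Q * H [t] - glueL t.1 (R Q) := by
  classical
  rw [R, R, sum_coarsenings_concat, map_sum, Finset.sum_mul, ← Finset.sum_sub_distrib]
  refine Finset.sum_congr rfl fun S _ => ?_
  have h1 : (((S ++ [t]).length : ℤ) - ((Q ++ [t]).length : ℤ)) = (S.length : ℤ) - Q.length := by
    simp
  rw [map_smul, glueL_H, smul_mul_assoc, H_mul_H, h1]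
  rcases List.eq_nil_or_concat' S with rfl | ⟨S, s, rfl⟩
  · simp
  · have h2 : (((S ++ [s]).length : ℤ) - (Q.length : ℤ)) =
        (((S ++ [s.append t.1]).length : ℤ) - ((Q ++ [t]).length : ℤ)) + 1 := by
      simp only [List.length_append, List.length_singleton, Nat.cast_add, Nat.cast_one]
      ring
    have h3 : (-1 : ℚ) ^ (((S ++ [s.append t.1]).length : ℤ) - ((Q ++ [t]).length : ℤ)) =
        -(-1 : ℚ) ^ (((S ++ [s]).length : ℤ) - (Q.length : ℤ)) := by
      rw [h2, zpow_add_one₀ (by norm_num), mul_neg_one, neg_neg]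
    rw [if_neg (by simp), if_neg (by simp), glueLast_concat, h3, neg_smul, ← sub_eq_add_neg]

theorem R_glueLast {A : Type u} [Finite A] [DecidableEq A] (S : Sentence A) (t : Word A) :
    (if S = [] then 0 else R (glueLast S t.1)) = glueL t.1 (R S) := by
  rcases List.eq_nil_or_concat' S with rfl | ⟨S, s, rfl⟩
  · rw [if_pos rfl, R_nil, ← H_nil, glueL_H, if_pos rfl]
  · rw [if_neg (by simp), glueLast_concat, R_concat, R_concat, map_sub, glueL_mul_H, glueL_glueL,
      Word.append]

/-- Möbius inversion of the definition of the ribbon functions. -/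
theorem H_eq_sum_R {A : Type u} [Finite A] (K : Sentence A) :
    H K = ∑ J ∈ coarsenings K, R J := by
  classical
  induction K using List.reverseRecOn with
  | nil => simp [coarsenings_nil, R_nil, H_nil]
  | append_singleton K t ih =>
    rw [sum_coarsenings_concat, ← H_mul_H, ih, Finset.sum_mul]
    refine Finset.sum_congr rfl fun S _ => ?_
    rw [R_glueLast, R_concat, sub_add_cancel]

/-! ### Skew dual immaculate functions -/

/-- The coefficient of a quasisymmetric function at `M_K`. -/
def coeffM {A : Type u} (K : Sentence A) : QSym A →ₗ[ℚ] ℚ where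
  toFun g := g.1 (canon K)
  map_add' _ _ := rfl
  map_smul' _ _ := rfl

theorem coeffM_apply {A : Type u} (K : Sentence A) (g : QSym A) : coeffM K g = g.1 (canon K) := rfl

theorem coeffM_M {A : Type u} [DecidableEq A] (K I : Sentence A) :
    coeffM K (M I) = if K = I then 1 else 0 := by
  simp [coeffM_apply, M, sentenceOf_canon]

theorem coeffM_ext {A : Type u} {g h : QSym A} (H : ∀ K, coeffM K g = coeffM K h) : g = h := by
  refine Subtype.ext (funext fun m => ?_)
  rw [g.2.1 m (canon (sentenceOf m)) (sentenceOf_canon _).symm,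
    h.2.1 m (canon (sentenceOf m)) (sentenceOf_canon _).symm]
  exact H _

theorem coeffM_sum_smul_M {A : Type u} [DecidableEq A] (K : Sentence A) (s : Finset (Sentence A))
    (c : Sentence A → ℚ) : coeffM K (∑ I ∈ s, c I • M I) = if K ∈ s then c K else 0 := by
  simp [map_sum, coeffM_M]

theorem dualImmaculate_eq_sum {A : Type u} [Finite A] (I : Sentence A) :
    dualImmaculate I = ∑ K ∈ sentences A (size I), tabCount I [] K • M K := by
  classical
  refine coeffM_ext fun K => ?_
  rw [coeffM_sum_smul_M, coeffM_apply, dualImmaculate_canon]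
  split_ifs with h
  · rfl
  · by_contra hc
    refine h (mem_sentences.2 ?_)
    rw [size_eq_of_tabCount_ne_zero hc, size_nil, zero_add]

/-- The dual bases `H`, `M` and `R`, `F` define the same canonical element. -/
theorem sum_H_M_eq_sum_R_F {A : Type u} [Finite A] (φ : NSym A →ₗ[ℚ] ℚ) (n : ℕ) :
    ∑ K ∈ sentences A n, φ (H K) • M K = ∑ K ∈ sentences A n, φ (R K) • F K := by
  simp only [H_eq_sum_R, F, map_sum, Finset.sum_smul, Finset.smul_sum]
  refine Finset.sum_comm' fun K J => ?_
  rw [mem_sentences, mem_sentences, mem_coarsenings, mem_refinements]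
  constructor
  · rintro ⟨h1, h2⟩
    exact ⟨h2, h2.size_eq.trans h1⟩
  · rintro ⟨h1, h2⟩
    exact ⟨h1.size_eq.symm.trans h2, h1⟩

/-- The dual bases `H`, `M` and `𝔖`, `𝔖*` define the same canonical element. -/
theorem sum_H_M_eq_sum_immaculate {A : Type u} [Finite A] (φ : NSym A →ₗ[ℚ] ℚ) (n : ℕ) :
    ∑ K ∈ sentences A n, φ (H K) • M K =
      ∑ K ∈ sentences A n, φ (immaculate K) • dualImmaculate K := by
  have h1 : ∀ K ∈ sentences A n, φ (H K) • M K =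
      ∑ I ∈ sentences A n, (tabCount I [] K * φ (immaculate I)) • M K := by
    intro K hK
    rw [H_eq_sum_immaculate, mem_sentences.1 hK, map_sum, Finset.sum_smul]
    simp only [map_smul, smul_eq_mul]
  have h2 : ∀ I ∈ sentences A n, φ (immaculate I) • dualImmaculate I =
      ∑ K ∈ sentences A n, (tabCount I [] K * φ (immaculate I)) • M K := by
    intro I hI
    rw [dualImmaculate_eq_sum, mem_sentences.1 hI, Finset.smul_sum]
    simp only [smul_smul, mul_comm]
  rw [Finset.sum_congr rfl h1, Finset.sum_congr rfl h2, Finset.sum_comm]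

theorem coeffM_skewDualImmaculate {A : Type u} [Finite A] (I J K : Sentence A) :
    coeffM K (skewDualImmaculate I J) = tabCount I J K := by
  classical
  rw [skewDualImmaculate, coeffM_sum_smul_M, pairing_immaculate_mul_H]
  split_ifs with h
  · rfl
  · by_contra hc
    refine h (mem_sentences.2 ?_)
    rw [size_eq_of_tabCount_ne_zero (Ne.symm hc), Nat.add_sub_cancel_left]

theorem skewDualImmaculate_val {A : Type u} [Finite A] {I J : Sentence A}
    (h : LeftContained J I) : (skewDualImmaculate I J).1 = tableauSeries I J := by
  have : skewDualImmaculate I J = ⟨tableauSeries I J, tableauSeries_mem I J⟩ :=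
    coeffM_ext fun K => by
      rw [coeffM_skewDualImmaculate, tabCount_of_leftContained h]
      rfl
  rw [this]

/-- Tableaux of type `K · L` on a straight shape split into a tableau of type `K` on a smaller
straight shape and a skew tableau of type `L`. This expresses the product
`H_{K · L} = H_K H_L` in terms of the immaculate functions. -/
theorem tabCount_append {A : Type u} [Finite A] (I K L : Sentence A) :
    tabCount I [] (K ++ L) = ∑ J ∈ subSentences I, tabCount J [] K * tabCount I J L := by
  classical
  have h1 : tabCount I [] (K ++ L) =
      ∑ J ∈ sentences A (size K), tabCount J [] K * tabCount I J L := by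
    rw [← pairing_immaculate_mul_H, immaculate_nil, one_mul, ← H_mul_H, H_eq_sum_immaculate,
      Finset.sum_mul, ← pairingL_apply, map_sum]
    refine Finset.sum_congr rfl fun J _ => ?_
    rw [smul_mul_assoc, map_smul, pairingL_apply, pairing_immaculate_mul_H, smul_eq_mul]
  rw [h1]
  have h2 : ∀ J, tabCount J [] K * tabCount I J L ≠ 0 →
      J ∈ sentences A (size K) ∧ J ∈ subSentences I := by
    intro J h
    refine ⟨mem_sentences.2 ?_, mem_subSentences.2 ?_⟩
    · rw [size_eq_of_tabCount_ne_zero (left_ne_zero_of_mul h), size_nil, zero_add]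
    · by_contra hc
      exact right_ne_zero_of_mul h (if_neg hc)
  refine Finset.sum_congr_of_eq_on_inter ?_ ?_ fun _ _ _ => rfl
  · intro J _ hJ
    by_contra hc
    exact hJ (h2 J hc).2
  · intro J _ hJ
    by_contra hc
    exact hJ (h2 J hc).1

/-- The coproduct is dual to the product of `NSym`: its coefficient at `M_K ⊗ M_L` is the
coefficient at `M_{K · L}`. -/
theorem repr_coproduct {A : Type u} [Finite A] (g : QSym A) (K L : Sentence A) :
    ((basisM A).tensorProduct (basisM A)).repr (coproduct A g) (K, L) = coeffM (K ++ L) g := by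
  classical
  change ((Finsupp.lapply (K, L)).comp
    (((basisM A).tensorProduct (basisM A)).repr.toLinearMap.comp (coproduct A))) g = _
  congr 1
  refine (basisM A).ext fun I => ?_
  rw [basisM_apply, coeffM_M]
  have h1 : coproduct A (M I) =
      ∑ i ∈ Finset.range (I.length + 1), M (I.take i) ⊗ₜ[ℚ] M (I.drop i) := by
    rw [coproduct, ← basisM_apply, Module.Basis.constr_basis]
  have h2 : ∀ J, (basisM A).repr (M J) = Finsupp.single J 1 := fun J => by
    rw [← basisM_apply, Module.Basis.repr_self]
  simp only [LinearMap.comp_apply, h1, map_sum, LinearEquiv.coe_coe, Finsupp.lapply_apply,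
    Module.Basis.tensorProduct_repr_tmul_apply, h2, Finsupp.single_apply, smul_eq_mul, mul_ite,
    mul_one, mul_zero]
  split_ifs with h
  · subst h
    rw [Finset.sum_eq_single K.length]
    · simp
    · intro i hi hiK
      rw [← ite_and, if_neg]
      rintro ⟨-, h⟩
      have := congrArg List.length h
      simp only [List.length_drop, List.length_append, Finset.mem_range] at this hi
      omega
    · intro h
      simp at h
  · refine Finset.sum_eq_zero fun i _ => ?_
    rw [← ite_and, if_neg]
    rintro ⟨rfl, rfl⟩
    exact h (List.take_append_drop i I)

theorem coproduct_dualImmaculate {A : Type u} [Finite A] (I : Sentence A) :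
    coproduct A (dualImmaculate I) =
      ∑ J ∈ subSentences I, dualImmaculate J ⊗ₜ[ℚ] skewDualImmaculate I J := by
  refine ((basisM A).tensorProduct (basisM A)).ext_elem ?_
  rintro ⟨K, L⟩
  have h : ∀ (g : QSym A) (K : Sentence A), (basisM A).repr g K = coeffM K g := fun _ _ => rfl
  rw [repr_coproduct, coeffM_apply, dualImmaculate_canon, tabCount_append, map_sum,
    Finsupp.finsetSum_apply]
  refine Finset.sum_congr rfl fun J _ => ?_
  rw [Module.Basis.tensorProduct_repr_tmul_apply, h, h, coeffM_skewDualImmaculate, coeffM_apply,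
    dualImmaculate_canon, smul_eq_mul, mul_comm]

end ColoredQSym

end

open ColoredQSym
theorem mainTheorem11 {A : Type*} [Finite A] :
    (∃ b : Module.Basis (Sentence A) ℚ (NSym A),
      (∀ I, b I = immaculate I) ∧
      (∀ I J K : Sentence A, b.repr (immaculate J * immaculate K) I =
        pairing (immaculate J * immaculate K) (dualImmaculate I).1) ∧
      (∀ I J : Sentence A, LeftContained J I →
        skewDualImmaculate I J = ∑ K ∈ sentences A (size I - size J),
          b.repr (immaculate J * immaculate K) I • dualImmaculate K)) ∧
    (∀ I J : Sentence A, LeftContained J I →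
      skewDualImmaculate I J = ∑ K ∈ sentences A (size I - size J),
          pairing (immaculate J * R K) (dualImmaculate I).1 • F K ∧
      skewDualImmaculate I J = ∑ K ∈ sentences A (size I - size J),
          pairing (immaculate J * immaculate K) (dualImmaculate I).1 • dualImmaculate K ∧
      (skewDualImmaculate I J).1 = tableauSeries I J) ∧
    (∀ I : Sentence A, coproduct A (dualImmaculate I) =
      ∑ J ∈ subSentences I, dualImmaculate J ⊗ₜ[ℚ] skewDualImmaculate I J) := by
  have h : ∀ I J : Sentence A, skewDualImmaculate I J = ∑ K ∈ sentences A (size I - size J),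
      pairing (immaculate J * immaculate K) (dualImmaculate I).1 • dualImmaculate K := fun I J =>
    sum_H_M_eq_sum_immaculate
      (pairingL (dualImmaculate I).1 ∘ₗ LinearMap.mulLeft ℚ (immaculate J)) _
  refine ⟨⟨immaculateBasis A, immaculateBasis_apply, fun I J K => immaculateBasis_repr _ _,
    fun I J _ => ?_⟩, fun I J hJI => ⟨?_, h I J, skewDualImmaculate_val hJI⟩,
    coproduct_dualImmaculate⟩
  · simp only [immaculateBasis_repr]
    exact h I J
  · exact sum_H_M_eq_sum_R_F
      (pairingL (dualImmaculate I).1 ∘ₗ LinearMap.mulLeft ℚ (immaculate J)) _
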